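/- \textbf{Conventions.} An exact category is an additive category with a family of kernel–cokernel pairs satisfying the axioms of Quillen in Keller's form; $\mathcal M$ and $\mathcal E$ denote its admissible monomorphisms and epimorphisms. An exact functor is an additive functor preserving the exact sequences. Weak equivalences of groupoids are equivalences of categories, fibrations are isofibrations; pullbacks of groupoids are strict. Let $\Sigma$ be $\Delta\times\Delta$ with a new terminal object $[-1]$ added, and let $p\colon\Sigma\to\Delta$ be the functor extending the ordinal sum, so that $p(q,r)=[q+1+r]$ and $p(-1)=[0]$. A preaugmented bisimplicial groupoid is a functor $Y\colon\Sigma^{\mathrm{op}}\to\mathcal Gpd$, and $S_\bullet=p_*$ is the right adjoint, given by right Kan extension, of $p^*$ from simplicial to preaugmented bisimplicial groupoids. For an exact category $\mathcal A$: \begin{itemize} \item The exact nerve $N^e\mathcal A$ has in degree $(q,r)$ the full subgroupoid of $\mathrm{Fun}([q]\times[r],\mathcal A)_{\mathrm{iso}}$ on the grids with horizontal morphisms $(i,j)\to(i,j')$ in $\mathcal M$, vertical morphisms $(i,j)\to(i',j)$ in $\mathcal E$ and all squares bicartesian; $(N^e\mathcal A)_{-1}$ is the groupoid of zero objects, included in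 $(N^e\mathcal A)_{0,0}=\mathcal A_{\mathrm{iso}}$. \item $S^e_n(\mathcal A)$ is the full subgroupoid of $\mathrm{Fun}(\mathrm{Ar}[n],\mathcal A)_{\mathrm{iso}}$, where $\mathrm{Ar}[n]=\mathrm{Fun}([1],[n])$, on the diagrams with horizontal morphisms in $\mathcal M$, vertical morphisms in $\mathcal E$, all squares bicartesian and (arbitrary) zero objects on the diagonal. \item The comparison map $c_{\mathcal A}\colon S^e_\bullet(\mathcal A)\to S_\bullet(N^e\mathcal A)$ is adjoint to the map $p^*S^e_\bullet(\mathcal A)\to N^e\mathcal A$ which in degree $(q,r)$ restricts diagrams along $[q]\times[r]\to\mathrm{Ar}[q+1+r]$, $(a,b)\mapsto(a\le q+1+b)$, and in degree $-1$ takes the value of a diagram of shape $\mathrm{Ar}[0]$. \end{itemize} For a simplicial object $X$ let $P^\triangleleft X=X([0]\star-)$, with the map $d_0\colon P^\triangleleft X\to X$ induced by the inclusions $[n]\to[0]\star[n]$. For a preaugmented bisimplicial object $Y$ let $(P^\triangleleft Y)_{q,r}=Y_{1+q,r}$ and $(P^\triangleleft Y)_{-1}=Y_{1,0}\times_{Y_{0,0}}Y_{-1}$,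 formed along $d_0\colon Y_{1,0}\to Y_{0,0}$, with augmentation map the first projection; again there is $d_0\colon P^\triangleleft Y\to Y$, the second projection in degree $-1$. Let $\varphi_Y\colon P^\triangleleft(S_\bullet Y)\to S_\bullet(P^\triangleleft Y)$ be the map adjoint to $p^*P^\triangleleft(S_\bullet Y)\to P^\triangleleft Y$ which in degree $(q,r)$ is the counit $(S_\bullet Y)_{(1+q)+1+r}\to Y_{1+q,r}$ and in degree $-1$ is the map $(S_\bullet Y)_1\to Y_{1,0}\times_{Y_{0,0}}Y_{-1}$ whose first component is the map $(S_\bullet Y)_1\to(S_\bullet Y)_2$ induced by $[2]\to[1]$, $0,1,2\mapsto 0,1,1$, followed by the counit $(S_\bullet Y)_2\to Y_{1,0}$, and whose second component is $d_0\colon(S_\bullet Y)_1\to(S_\bullet Y)_0$ followed by the counit $(S_\bullet Y)_0\to Y_{-1}$. For an exact functor $f\colon\mathcal A\to\mathcal B$ set \[ S^{\mathrm{rel}}_\bullet(f)=P^\triangleleft S^e_\bullet(\mathcal B)\times_{S^e_\bullet(\mathcal B)}S^e_\bullet(\mathcal A),\qquad N^{\mathrm{rel}}f=P^\triangleleft(N^e\mathcal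 B)\times_{N^e\mathcal B}N^e\mathcal A, \] the pullbacks of $d_0$ along $S^e_\bullet(f)$ and along $N^ef$, respectively. \textbf{Theorem.} Let $f\colon\mathcal A\to\mathcal B$ be an exact functor of exact categories. The comparison maps $c_{\mathcal A}\colon S^e_\bullet(\mathcal A)\to S_\bullet(N^e\mathcal A)$ and $c_{\mathcal B}\colon S^e_\bullet(\mathcal B)\to S_\bullet(N^e\mathcal B)$ are isomorphisms of simplicial groupoids, the map $\varphi_{N^e\mathcal B}\colon P^\triangleleft(S_\bullet N^e\mathcal B)\to S_\bullet(P^\triangleleft N^e\mathcal B)$ is a levelwise acyclic fibration of groupoids, and there is a levelwise weak equivalence of simplicial groupoids \[ w\colon S^{\mathrm{rel}}_\bullet(f)\longrightarrow S_\bullet(N^{\mathrm{rel}}f) \] which is induced by these maps: its composite with $S_\bullet(N^{\mathrm{rel}}f)\to S_\bullet(P^\triangleleft N^e\mathcal B)$ is the projection to $P^\triangleleft S^e_\bullet(\mathcal B)$ followed by $\varphi_{N^e\mathcal B}\circ P^\triangleleft(c_{\mathcal B})$, and its composite with $S_\bullet(N^{\mathrm{rel}}f)\to S_\bullet(N^e\mathcal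 A)$ is the projection to $S^e_\bullet(\mathcal A)$ followed by $c_{\mathcal A}$. -/

import Mathlib

open CategoryTheory CategoryTheory.Limits Opposite
open scoped Simplicial

universe v u

namespace Sdot

/-! ## Small limits of groupoids -/

section GrpdLimits

variable {J : Type} [SmallCategory J] (F : J ⥤ Grpd.{v, u})

/-- The explicit limit of a diagram of groupoids: objects are strictly compatible families of
objects, morphisms are compatible families of morphisms. -/
structure GrpdLimit where
  obj : ∀ j, F.obj j
  compat : ∀ {i j : J} (f : i ⟶ j), (F.map f).obj (obj i) = obj j

namespace GrpdLimit

variable {F}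

/-- Compatible families of morphisms. -/
@[ext]
structure Hom (x y : GrpdLimit F) where
  app : ∀ j, x.obj j ⟶ y.obj j
  compat : ∀ {i j : J} (f : i ⟶ j),
    (F.map f).map (app i) = eqToHom (x.compat f) ≫ app j ≫ eqToHom (y.compat f).symm

instance groupoid : Groupoid.{v} (GrpdLimit F) where
  Hom := Hom
  id x := ⟨fun _ => 𝟙 _, fun f => by simp⟩
  comp a b := ⟨fun j => a.app j ≫ b.app j, fun f => by simp [a.compat f, b.compat f]⟩
  id_comp a := Hom.ext (by funext j; exact Category.id_comp _)
  comp_id a := Hom.ext (by funext j; exact Category.comp_id _)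
  assoc a b c := Hom.ext (by funext j; exact Category.assoc _ _ _)
  inv a := ⟨fun j => Groupoid.inv (a.app j), fun f => by
    simp only [Groupoid.inv_eq_inv, Functor.map_inv, a.compat f, IsIso.inv_comp, inv_eqToHom,
      Category.assoc]⟩
  inv_comp a := Hom.ext (by funext j; exact Groupoid.inv_comp _)
  comp_inv a := Hom.ext (by funext j; exact Groupoid.comp_inv _)

theorem hom_ext {x y : GrpdLimit F} {a b : x ⟶ y} (h : ∀ j, a.app j = b.app j) : a = b :=
  Hom.ext (funext h)

theorem obj_ext {x y : GrpdLimit F} (h : ∀ j, x.obj j = y.obj j) : x = y := by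
  cases x; cases y; congr; exact funext h

theorem eqToHom_app {x y : GrpdLimit F} (h : x = y) (j : J) :
    Hom.app (eqToHom h : x ⟶ y) j = eqToHom (by rw [h]) := by
  subst h; rfl

variable (F)

theorem eq_conj {C : Type u} [Category.{v} C] {X Y X' Y' : C} (a : X ⟶ Y) (b : X' ⟶ Y')
    (h₁ : X' = X) (h₂ : Y = Y') (h : b = eqToHom h₁ ≫ a ≫ eqToHom h₂) (h₃ : X = X')
    (h₄ : Y' = Y) : a = eqToHom h₃ ≫ b ≫ eqToHom h₄ := by
  subst h₁ h₂ h; simp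

/-- The projections of the explicit limit. -/
def proj (j : J) : GrpdLimit F ⥤ F.obj j where
  obj x := x.obj j
  map a := Hom.app a j
  map_id _ := rfl
  map_comp _ _ := rfl

/-- The explicit limit cone. -/
def cone : Cone F where
  pt := Grpd.of (GrpdLimit F)
  π :=
    { app := fun j => (proj F j : GrpdLimit F ⥤ F.obj j)
      naturality := fun i j f => by
        refine CategoryTheory.Functor.ext (fun x => (x.compat f).symm) (fun x y a => ?_)
        exact eq_conj _ _ _ _ (Hom.compat a f) _ _ }

/-- The functor into the explicit limit given by a cone. -/
def lift (s : Cone F) : s.pt ⥤ GrpdLimit F where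
  obj x := ⟨fun j => (s.π.app j).obj x, fun f => Functor.congr_obj (s.w f) x⟩
  map a := ⟨fun j => (s.π.app j).map a, fun f => Functor.congr_hom (s.w f) a⟩
  map_id x := hom_ext fun j => (s.π.app j).map_id x
  map_comp a b := hom_ext fun j => (s.π.app j).map_comp a b

/-- The explicit cone is a limit cone. -/
def isLimit : IsLimit (cone F) where
  lift s := lift F s
  fac s j := rfl
  uniq s m w := by
    have h (x : s.pt) : (show s.pt ⥤ GrpdLimit F from m).obj x = (lift F s).obj x :=
      obj_ext fun j => Functor.congr_obj (w j) x
    refine CategoryTheory.Functor.ext h (fun x y a => hom_ext fun j => ?_)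
    refine (Functor.congr_hom (w j) a).trans ?_
    exact congrArg₂ (fun p q => p ≫ (s.π.app j).map a ≫ q) (eqToHom_app (h x) j).symm
      (eqToHom_app (h y).symm j).symm

end GrpdLimit

instance grpd_hasLimits : HasLimitsOfSize.{0, 0} Grpd.{v, u} where
  has_limits_of_shape _ _ := ⟨fun F => ⟨⟨⟨GrpdLimit.cone F, GrpdLimit.isLimit F⟩⟩⟩⟩

end GrpdLimits

/-! ## The canonical model structure on groupoids: weak equivalences and fibrations -/

/-- An isofibration: every isomorphism out of the image of an object lifts. -/
def IsIsofibration {X Y : Grpd.{v, u}} (G : X ⟶ Y) : Prop :=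
  ∀ (x : X) (y : Y) (e : G.obj x ⟶ y), ∃ (x' : X) (e' : x ⟶ x') (h : G.obj x' = y),
    G.map e' ≫ eqToHom h = e

/-- A map of simplicial groupoids which is an equivalence of groupoids in each degree. -/
def LevelwiseWeakEquivalence {X Y : SimplexCategoryᵒᵖ ⥤ Grpd.{v, u}} (w : X ⟶ Y) : Prop :=
  ∀ n, Functor.IsEquivalence (w.app n)

/-- A map of simplicial groupoids which is an equivalence and an isofibration in each degree. -/
def LevelwiseAcyclicFibration {X Y : SimplexCategoryᵒᵖ ⥤ Grpd.{v, u}} (w : X ⟶ Y) : Prop :=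
  ∀ n, Functor.IsEquivalence (w.app n) ∧ IsIsofibration (w.app n)

/-! ## Exact categories -/

section Exact

/-- `i` is an admissible monomorphism for the family `S` if it is the first map of a sequence
in `S`. -/
def admMono {A : Type u} [Category.{v} A] [Preadditive A] (S : ObjectProperty (ShortComplex A)) :
    MorphismProperty A :=
  fun _ Y i => ∃ (Z : A) (p : Y ⟶ Z) (w : i ≫ p = 0), S (ShortComplex.mk i p w)

/-- `p` is an admissible epimorphism for the family `S` if it is the second map of a sequence
in `S`. -/
def admEpi {A : Type u} [Category.{v} A] [Preadditive A] (S : ObjectProperty (ShortComplex A)) :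
    MorphismProperty A :=
  fun Y _ p => ∃ (X : A) (i : X ⟶ Y) (w : i ≫ p = 0), S (ShortComplex.mk i p w)

/-- An exact category: an additive category with a family of kernel-cokernel pairs, satisfying
the axioms of Quillen in Keller's form. -/
class ExactCategory (A : Type u) [Category.{v} A] [Preadditive A] [HasFiniteBiproducts A] where
  /-- the family of exact sequences -/
  seq : ObjectProperty (ShortComplex A)
  isKernel : ∀ S : ShortComplex A, seq S → Nonempty (IsLimit (KernelFork.ofι S.f S.zero))
  isCokernel : ∀ S : ShortComplex A, seq S → Nonempty (IsColimit (CokernelCofork.ofπ S.g S.zero))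
  of_iso : ∀ {S T : ShortComplex A}, (S ≅ T) → seq S → seq T
  admEpi_id_zero : ∀ Z : A, IsZero Z → admEpi seq (𝟙 Z)
  admEpi_comp : ∀ {X Y Z : A} (p : X ⟶ Y) (q : Y ⟶ Z),
    admEpi seq p → admEpi seq q → admEpi seq (p ≫ q)
  pullback : ∀ {C C' B' : A} (f : C ⟶ C') (p' : B' ⟶ C'), admEpi seq p' →
    ∃ (B : A) (g : B ⟶ B') (p : B ⟶ C), IsPullback g p p' f ∧ admEpi seq p
  pushout : ∀ {X X' Y : A} (g : X ⟶ X') (i : X ⟶ Y), admMono seq i →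
    ∃ (Y' : A) (h : Y ⟶ Y') (i' : X' ⟶ Y'), IsPushout i g h i' ∧ admMono seq i'

variable {A : Type u} [Category.{v} A] [Preadditive A] [HasFiniteBiproducts A] [ExactCategory A]
variable {B : Type u} [Category.{v} B] [Preadditive B] [HasFiniteBiproducts B] [ExactCategory B]

variable (A) in
/-- The admissible monomorphisms of an exact category. -/
abbrev M : MorphismProperty A := admMono (ExactCategory.seq (A := A))

variable (A) in
/-- The admissible epimorphisms of an exact category. -/
abbrev E : MorphismProperty A := admEpi (ExactCategory.seq (A := A))

/-- An exact functor: an additive functor which preserves exact sequences. -/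
class IsExactFunctor (f : A ⥤ B) [f.Additive] : Prop where
  map_seq : ∀ S : ShortComplex A, ExactCategory.seq S → ExactCategory.seq (S.map f)

/-- A square which is both a pullback and a pushout. -/
def Bicartesian {C : Type u} [Category.{v} C] {X Y Z W : C} (a : X ⟶ Y) (b : X ⟶ Z) (c : Y ⟶ W)
    (d : Z ⟶ W) : Prop :=
  IsPullback a b c d ∧ IsPushout a b c d

theorem seq_of_isZero (S : ShortComplex A) (h₁ : IsZero S.X₁) (h₂ : IsZero S.X₂)
    (h₃ : IsZero S.X₃) : ExactCategory.seq S := by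
  obtain ⟨K, i, w, h⟩ := ExactCategory.admEpi_id_zero _ h₂
  obtain ⟨l⟩ := ExactCategory.isKernel _ h
  have : Mono i := Fork.IsLimit.mono l
  have hK : IsZero K := IsZero.of_mono i h₂
  exact ExactCategory.of_iso (S := ShortComplex.mk i (𝟙 S.X₂) w) (T := S)
    (ShortComplex.isoMk (hK.iso h₁) (Iso.refl S.X₂) (h₂.iso h₃)
      (hK.eq_of_src _ _) (h₂.eq_of_src _ _)) h

theorem M_map (f : A ⥤ B) [f.Additive] [IsExactFunctor f] {X Y : A} (i : X ⟶ Y) (h : M A i) :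
    M B (f.map i) := by
  obtain ⟨Z, p, w, h⟩ := h
  exact ⟨f.obj Z, f.map p, by rw [← f.map_comp, w, f.map_zero], IsExactFunctor.map_seq _ h⟩

theorem E_map (f : A ⥤ B) [f.Additive] [IsExactFunctor f] {X Y : A} (i : X ⟶ Y) (h : E A i) :
    E B (f.map i) := by
  obtain ⟨Z, p, w, h⟩ := h
  exact ⟨f.obj Z, f.map p, by rw [← f.map_comp, w, f.map_zero], IsExactFunctor.map_seq _ h⟩

/-- A commutative square whose rows have the same cokernel and whose columns have the same
kernel is bicartesian. -/
theorem bicartesian_of_seq {X Y Z W K Q : A} {a : X ⟶ Y} {b : X ⟶ Z} {c : Y ⟶ W} {d : Z ⟶ W}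
    {k : K ⟶ X} {r : W ⟶ Q} (sq : a ≫ c = b ≫ d)
    (w₁ : k ≫ b = 0) (h₁ : ExactCategory.seq (ShortComplex.mk k b w₁))
    (w₂ : (k ≫ a) ≫ c = 0) (h₂ : ExactCategory.seq (ShortComplex.mk (k ≫ a) c w₂))
    (w₃ : a ≫ (c ≫ r) = 0) (h₃ : ExactCategory.seq (ShortComplex.mk a (c ≫ r) w₃))
    (w₄ : d ≫ r = 0) (h₄ : ExactCategory.seq (ShortComplex.mk d r w₄)) :
    Bicartesian a b c d := by
  obtain ⟨l₃⟩ := ExactCategory.isKernel _ h₃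
  obtain ⟨l₄⟩ := ExactCategory.isKernel _ h₄
  obtain ⟨l₁⟩ := ExactCategory.isCokernel _ h₁
  obtain ⟨l₂⟩ := ExactCategory.isCokernel _ h₂
  have : Mono a := Fork.IsLimit.mono l₃
  have : Mono d := Fork.IsLimit.mono l₄
  have : Epi b := Cofork.IsColimit.epi l₁
  have : Epi c := Cofork.IsColimit.epi l₂
  refine ⟨⟨⟨sq⟩, ⟨PullbackCone.IsLimit.mk _ (fun s => (KernelFork.IsLimit.lift' l₃ s.fst ?_).1)
    (fun s => ?_) (fun s => ?_) (fun s m h _ => ?_)⟩⟩,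
    ⟨⟨sq⟩, ⟨PushoutCocone.IsColimit.mk _ (fun s => (CokernelCofork.IsColimit.desc' l₂ s.inl ?_).1)
    (fun s => ?_) (fun s => ?_) (fun s m h _ => ?_)⟩⟩⟩
  · rw [← Category.assoc]
    change (s.fst ≫ c) ≫ r = 0
    rw [s.condition, Category.assoc, w₄, comp_zero]
  · exact (KernelFork.IsLimit.lift' l₃ s.fst _).2
  · rw [← cancel_mono d, Category.assoc, ← sq, ← Category.assoc]
    refine Eq.trans ?_ s.condition
    exact congrArg (· ≫ c) (KernelFork.IsLimit.lift' l₃ s.fst _).2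
  · rw [← cancel_mono a, h]
    exact (KernelFork.IsLimit.lift' l₃ s.fst _).2.symm
  · change (k ≫ a) ≫ s.inl = 0
    rw [Category.assoc, s.condition, ← Category.assoc, w₁, zero_comp]
  · exact (CokernelCofork.IsColimit.desc' l₂ s.inl _).2
  · rw [← cancel_epi b, ← Category.assoc, ← sq, Category.assoc]
    refine Eq.trans ?_ s.condition
    exact congrArg (a ≫ ·) (CokernelCofork.IsColimit.desc' l₂ s.inl _).2
  · rw [← cancel_epi c, h]
    exact (CokernelCofork.IsColimit.desc' l₂ s.inl _).2.symm

/-- Exact functors preserve the bicartesian squares of exact nerves. -/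
theorem Bicartesian.map (f : A ⥤ B) [f.Additive] [IsExactFunctor f] {X Y Z W : A} {a : X ⟶ Y}
    {b : X ⟶ Z} {c : Y ⟶ W} {d : Z ⟶ W} (h : Bicartesian a b c d) (ha : M A a) (hb : E A b)
    (hc : E A c) (hd : M A d) : Bicartesian (f.map a) (f.map b) (f.map c) (f.map d) := by
  obtain ⟨hl, hr⟩ := h
  obtain ⟨K, k, w₁, h₁⟩ := hb
  obtain ⟨Q, r, w₄, h₄⟩ := hd
  obtain ⟨K', k', w₂, h₂⟩ := hc
  obtain ⟨Q', r', w₃, h₃⟩ := ha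
  have w₂' : (k ≫ a) ≫ c = 0 := by rw [Category.assoc, hl.w, ← Category.assoc, w₁, zero_comp]
  have w₃' : a ≫ (c ≫ r) = 0 := by
    rw [← Category.assoc, hl.w, Category.assoc, w₄, comp_zero]
  have h₂' : ExactCategory.seq (ShortComplex.mk (k ≫ a) c w₂') := by
    obtain ⟨l₁⟩ := ExactCategory.isKernel _ h₁
    obtain ⟨l₂⟩ := ExactCategory.isKernel _ h₂
    have : Mono k := Fork.IsLimit.mono l₁
    have : Mono k' := Fork.IsLimit.mono l₂
    obtain ⟨s, hs⟩ := KernelFork.IsLimit.lift' l₂ (k ≫ a) w₂'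
    have e : k' ≫ c = (0 : K' ⟶ Z) ≫ d := by rw [w₂, zero_comp]
    obtain ⟨t, ht⟩ := KernelFork.IsLimit.lift' l₁ (hl.lift k' 0 e) (hl.lift_snd _ _ _)
    change s ≫ k' = k ≫ a at hs
    change t ≫ k = _ at ht
    have hts : t ≫ s = 𝟙 K' := by
      rw [← cancel_mono k', Category.assoc, hs, ← Category.assoc, ht, hl.lift_fst,
        Category.id_comp]
    have hst : s ≫ t = 𝟙 K := by
      rw [← cancel_mono k, Category.assoc, ht, Category.id_comp]
      apply hl.hom_ext
      · rw [Category.assoc, hl.lift_fst, hs]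
      · rw [Category.assoc, hl.lift_snd, comp_zero, w₁]
    refine ExactCategory.of_iso (S := ShortComplex.mk k' c w₂) (ShortComplex.isoMk
      (show K' ≅ K from ⟨t, s, hts, hst⟩) (Iso.refl Y) (Iso.refl W) ?_ ?_) h₂
    · change t ≫ k ≫ a = k' ≫ 𝟙 Y
      rw [← Category.assoc, ht, hl.lift_fst, Category.comp_id]
    · change 𝟙 Y ≫ c = c ≫ 𝟙 W
      rw [Category.comp_id, Category.id_comp]
  have h₃' : ExactCategory.seq (ShortComplex.mk a (c ≫ r) w₃') := by
    obtain ⟨l₄⟩ := ExactCategory.isCokernel _ h₄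
    obtain ⟨l₃⟩ := ExactCategory.isCokernel _ h₃
    have : Epi r := Cofork.IsColimit.epi l₄
    have : Epi r' := Cofork.IsColimit.epi l₃
    obtain ⟨s, hs⟩ := CokernelCofork.IsColimit.desc' l₃ (c ≫ r) w₃'
    have e : a ≫ r' = b ≫ (0 : Z ⟶ Q') := by rw [w₃, comp_zero]
    obtain ⟨t, ht⟩ := CokernelCofork.IsColimit.desc' l₄ (hr.desc r' 0 e) (hr.inr_desc _ _ _)
    change r' ≫ s = c ≫ r at hs
    change r ≫ t = _ at ht
    have hst : s ≫ t = 𝟙 Q' := by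
      rw [← cancel_epi r', ← Category.assoc, hs, Category.assoc, ht, hr.inl_desc,
        Category.comp_id]
    have hts : t ≫ s = 𝟙 Q := by
      rw [← cancel_epi r, ← Category.assoc, ht, Category.comp_id]
      apply hr.hom_ext
      · rw [← Category.assoc, hr.inl_desc, hs]
      · rw [← Category.assoc, hr.inr_desc, zero_comp, w₄]
    refine ExactCategory.of_iso (S := ShortComplex.mk a r' w₃) (ShortComplex.isoMk
      (Iso.refl X) (Iso.refl Y) (show Q' ≅ Q from ⟨s, t, hst, hts⟩) ?_ ?_) h₃
    · change 𝟙 X ≫ a = a ≫ 𝟙 Y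
      rw [Category.comp_id, Category.id_comp]
    · change 𝟙 Y ≫ c ≫ r = r' ≫ s
      rw [Category.id_comp, hs]
  refine bicartesian_of_seq (k := f.map k) (r := f.map r) ?_ ?_ ?_ ?_ ?_ ?_ ?_ ?_ ?_
  · rw [← f.map_comp, hl.w, f.map_comp]
  · rw [← f.map_comp, w₁, f.map_zero]
  · exact IsExactFunctor.map_seq _ h₁
  · rw [← f.map_comp, ← f.map_comp, w₂', f.map_zero]
  · have := IsExactFunctor.map_seq (f := f) _ h₂'
    simpa only [ShortComplex.map, Functor.map_comp] using this
  · rw [← f.map_comp, ← f.map_comp, w₃', f.map_zero]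
  · have := IsExactFunctor.map_seq (f := f) _ h₃'
    simpa only [ShortComplex.map, Functor.map_comp] using this
  · rw [← f.map_comp, w₄, f.map_zero]
  · exact IsExactFunctor.map_seq _ h₄

end Exact

/-! ## Index categories -/

abbrev DeltaSq : Type := SimplexCategory × SimplexCategory

/-- The category `Δ × Δ` with a new terminal object `[-1]` added. -/
abbrev SigmaCat : Type := WithTerminal DeltaSq

/-- The ordinal sum of two monotone maps. -/
def joinHom {m m' n n' : SimplexCategory} (f : m ⟶ m') (g : n ⟶ n') :
    (⦋m.len + n.len + 1⦌ : SimplexCategory) ⟶ ⦋m'.len + n'.len + 1⦌ :=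
  SimplexCategory.mkHom
    { toFun := fun i =>
        if h : i.val ≤ m.len then
          ⟨(f.toOrderHom ⟨i.val, by omega⟩).val, by omega⟩
        else
          ⟨m'.len + 1 + (g.toOrderHom ⟨i.val - (m.len + 1), by omega⟩).val, by omega⟩
      monotone' := fun a b hab => by
        have hab' : a.val ≤ b.val := hab
        by_cases ha : a.val ≤ m.len <;> by_cases hb : b.val ≤ m.len
        · simpa [ha, hb] using f.toOrderHom.monotone (Fin.mk_le_mk.2 hab')
        · simp only [ha, hb, dite_true, dite_false, Fin.mk_le_mk]
          omega
        · omega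
        · simp only [ha, hb, dite_false, Fin.mk_le_mk]
          have := g.toOrderHom.monotone (a := ⟨a.val - (m.len + 1), by omega⟩)
            (b := ⟨b.val - (m.len + 1), by omega⟩) (Fin.mk_le_mk.2 (by omega))
          have : (g.toOrderHom ⟨a.val - (m.len + 1), by omega⟩).val ≤
            (g.toOrderHom ⟨b.val - (m.len + 1), by omega⟩).val := this
          omega }

theorem joinHom_left {m m' n n' : SimplexCategory} (f : m ⟶ m') (g : n ⟶ n')
    (i : Fin (m.len + n.len + 1 + 1)) (a : Fin (m.len + 1)) (h : i.val = a.val) :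
    ((joinHom f g).toOrderHom i).val = (f.toOrderHom a).val := by
  obtain ⟨i, hi⟩ := i
  obtain ⟨a, ha⟩ := a
  subst h
  change Fin.val (dite _ _ _) = _
  rw [dif_pos (Nat.lt_succ_iff.1 ha)]

theorem joinHom_right {m m' n n' : SimplexCategory} (f : m ⟶ m') (g : n ⟶ n')
    (i : Fin (m.len + n.len + 1 + 1)) (b : Fin (n.len + 1)) (h : i.val = m.len + 1 + b.val) :
    ((joinHom f g).toOrderHom i).val = m'.len + 1 + (g.toOrderHom b).val := by
  obtain ⟨i, hi⟩ := i
  obtain ⟨b, hb⟩ := b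
  subst h
  change Fin.val (dite _ _ _) = _
  rw [dif_neg (show ¬ m.len + 1 + b ≤ m.len by omega)]
  simp only [Nat.add_sub_cancel_left]

/-- Every vertex of `[m + 1 + n]` lies either in `[m]` or in `[n]`. -/
theorem join_cases (m n : ℕ) (i : Fin (m + n + 1 + 1)) :
    (∃ a : Fin (m + 1), i.val = a.val) ∨ ∃ b : Fin (n + 1), i.val = m + 1 + b.val := by
  by_cases h : i.val ≤ m
  · exact Or.inl ⟨⟨i.val, by omega⟩, rfl⟩
  · exact Or.inr ⟨⟨i.val - (m + 1), by omega⟩, by simp only; omega⟩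

theorem hom_ext_val {m n : SimplexCategory} {f g : m ⟶ n}
    (h : ∀ i, (f.toOrderHom i).val = (g.toOrderHom i).val) : f = g :=
  SimplexCategory.Hom.ext _ _ (OrderHom.ext _ _ (funext fun i => Fin.ext (h i)))

theorem joinHom_id (m n : SimplexCategory) :
    joinHom (𝟙 m) (𝟙 n) = 𝟙 (⦋m.len + n.len + 1⦌ : SimplexCategory) :=
  hom_ext_val fun i => by
    obtain ⟨a, ha⟩ | ⟨b, hb⟩ := join_cases m.len n.len i
    · exact (joinHom_left _ _ i a ha).trans ha.symm
    · exact (joinHom_right _ _ i b hb).trans hb.symm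

theorem joinHom_comp {m m' m'' n n' n'' : SimplexCategory} (f : m ⟶ m') (f' : m' ⟶ m'')
    (g : n ⟶ n') (g' : n' ⟶ n'') :
    joinHom (f ≫ f') (g ≫ g') = joinHom f g ≫ joinHom f' g' :=
  hom_ext_val fun i => by
    obtain ⟨a, ha⟩ | ⟨b, hb⟩ := join_cases m.len n.len i
    · exact (joinHom_left _ _ i a ha).trans
        (joinHom_left f' g' _ (f.toOrderHom a) (joinHom_left f g i a ha)).symm
    · exact (joinHom_right _ _ i b hb).trans
        (joinHom_right f' g' _ (g.toOrderHom b) (joinHom_right f g i b hb)).symm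

/-- The ordinal sum, on objects `([m], [n]) ↦ [m + 1 + n]`. -/
def join : DeltaSq ⥤ SimplexCategory where
  obj x := ⦋x.1.len + x.2.len + 1⦌
  map g := joinHom g.1 g.2
  map_id x := joinHom_id x.1 x.2
  map_comp f g := joinHom_comp f.1 g.1 f.2 g.2

/-- The extension `p : Σ ⥤ Δ` of the ordinal sum which sends `[-1]` to `[0]`. -/
def p : SigmaCat ⥤ SimplexCategory :=
  WithTerminal.liftToTerminal join SimplexCategory.isTerminalZero

/-- Join with an initial object, `[n] ↦ [0] ⋆ [n]`. -/
def j : SimplexCategory ⥤ SimplexCategory :=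
  Prod.sectR ⦋0⦌ SimplexCategory ⋙ join

/-- The inclusion `[n] ⟶ [0] ⋆ [n]`, which omits the initial vertex. -/
def inclJ (n : SimplexCategory) : n ⟶ (⦋0 + n.len + 1⦌ : SimplexCategory) :=
  SimplexCategory.mkHom (n := n.len)
    { toFun := fun i => ⟨i.val + 1, by omega⟩
      monotone' := fun a b h => by
        have : a.val ≤ b.val := h
        simpa using this }

/-- The inclusions `[n] ⟶ [0] ⋆ [n]` are natural. -/
def toJ : 𝟭 SimplexCategory ⟶ j where
  app n := inclJ n
  naturality m _ f := hom_ext_val fun i =>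
    (Nat.add_comm _ _).trans (joinHom_right (𝟙 (⦋0⦌ : SimplexCategory)) f
      ((inclJ m).toOrderHom i) i (Nat.add_comm _ _)).symm

/-- The identification `([0] ⋆ [k]) ⋆ [l] = [0] ⋆ ([k] ⋆ [l])`. -/
def assocHom (k l : SimplexCategory) :
    (⦋0 + k.len + 1 + l.len + 1⦌ : SimplexCategory) ⟶ ⦋0 + (k.len + l.len + 1) + 1⦌ :=
  SimplexCategory.mkHom
    { toFun := fun i => ⟨i.val, by omega⟩
      monotone' := fun _ _ h => h }

theorem assocHom_naturality {k k' l l' : SimplexCategory} (f : k ⟶ k') (g : l ⟶ l') :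
    joinHom (joinHom (𝟙 (⦋0⦌ : SimplexCategory)) f) g ≫ assocHom k' l' =
      assocHom k l ≫ joinHom (𝟙 (⦋0⦌ : SimplexCategory)) (joinHom f g) :=
  hom_ext_val fun i => by
    change ((joinHom (joinHom (𝟙 (⦋0⦌ : SimplexCategory)) f) g).toOrderHom i).val =
      ((joinHom (𝟙 (⦋0⦌ : SimplexCategory)) (joinHom f g)).toOrderHom
        ((assocHom k l).toOrderHom i)).val
    obtain ⟨a, ha⟩ | ⟨b, hb⟩ := join_cases (0 + k.len + 1) l.len i
    · refine (joinHom_left (joinHom (𝟙 (⦋0⦌ : SimplexCategory)) f) g i a ha).trans ?_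
      obtain ⟨c, hc⟩ | ⟨c, hc⟩ := join_cases 0 k.len a
      · exact (joinHom_left (𝟙 (⦋0⦌ : SimplexCategory)) f a c hc).trans
          (joinHom_left (𝟙 (⦋0⦌ : SimplexCategory)) (joinHom f g) _ c (ha.trans hc)).symm
      · refine (joinHom_right (𝟙 (⦋0⦌ : SimplexCategory)) f a c hc).trans ?_
        refine Eq.trans ?_ (joinHom_right (𝟙 (⦋0⦌ : SimplexCategory)) (joinHom f g) _
          (⟨c.val, by omega⟩ : Fin (k.len + l.len + 1 + 1)) (ha.trans hc)).symm
        exact congrArg (0 + 1 + ·) (joinHom_left f g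
          (⟨c.val, by omega⟩ : Fin (k.len + l.len + 1 + 1)) c rfl).symm
    · refine (joinHom_right (joinHom (𝟙 (⦋0⦌ : SimplexCategory)) f) g i b hb).trans ?_
      refine Eq.trans ?_ (joinHom_right (𝟙 (⦋0⦌ : SimplexCategory)) (joinHom f g) _
          (⟨k.len + 1 + b.val, by omega⟩ : Fin (k.len + l.len + 1 + 1))
          (hb.trans (by change 0 + k.len + 1 + 1 + b.val = 0 + 1 + (k.len + 1 + b.val); omega))).symm
      refine Eq.trans ?_ (congrArg (0 + 1 + ·) (joinHom_right f g
          (⟨k.len + 1 + b.val, by omega⟩ : Fin (k.len + l.len + 1 + 1)) b rfl).symm)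
      change 0 + k'.len + 1 + 1 + _ = 0 + 1 + (k'.len + 1 + _)
      omega

theorem joinHom_inclJ (k l : SimplexCategory) :
    joinHom (inclJ k) (𝟙 l) ≫ assocHom k l = inclJ ⦋k.len + l.len + 1⦌ :=
  hom_ext_val fun i => by
    change ((joinHom (inclJ k) (𝟙 l)).toOrderHom i).val = i.val + 1
    obtain ⟨a, ha⟩ | ⟨b, hb⟩ := join_cases k.len l.len i
    · exact (joinHom_left _ _ i a ha).trans (congrArg (· + 1) ha.symm)
    · refine (joinHom_right _ _ i b hb).trans ?_
      rw [hb]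
      change 0 + k.len + 1 + 1 + b.val = _
      omega

/-- The associativity of the join, as a natural transformation. -/
def assocJ : j.prod (𝟭 SimplexCategory) ⋙ join ⟶ join ⋙ j where
  app x := assocHom x.1 x.2
  naturality _ _ f := assocHom_naturality f.1 f.2

/-- The object `(0, 0)` of `Δ × Δ`. -/
abbrev zz : DeltaSq := (⦋0⦌, ⦋0⦌)

/-- The object `(0, 0)` is terminal in `Δ × Δ`. -/
def zzTerminal : IsTerminal zz :=
  IsTerminal.ofUniqueHom
    (fun x => (SimplexCategory.isTerminalZero.from x.1, SimplexCategory.isTerminalZero.from x.2))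
    (fun _ _ => Prod.ext (SimplexCategory.isTerminalZero.hom_ext _ _)
      (SimplexCategory.isTerminalZero.hom_ext _ _))

/-! ## Preaugmented bisimplicial objects -/

section Preaug

universe w' w

/-- Preaugmented bisimplicial objects. -/
abbrev Preaug (C : Type w) [Category.{w'} C] : Type _ := SigmaCatᵒᵖ ⥤ C

variable {C : Type w} [Category.{w'} C]

namespace Preaug

/-- The underlying bisimplicial object. -/
abbrev under (Y : Preaug C) : DeltaSqᵒᵖ ⥤ C := WithTerminal.incl.op ⋙ Y

/-- The augmentation `Y_{-1}`. -/
abbrev augObj (Y : Preaug C) : C := Y.obj (op WithTerminal.star)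

/-- The augmentation map `Y_{-1} ⟶ Y_{0,0}`. -/
abbrev aug (Y : Preaug C) : Y.augObj ⟶ Y.under.obj (op zz) :=
  Y.map (WithTerminal.homFrom zz).op

/-- The preaugmented bisimplicial object given by a bisimplicial object `Y` and a map
`Z ⟶ Y_{0,0}`. -/
def mk (Y : DeltaSqᵒᵖ ⥤ C) (Z : C) (ε : Z ⟶ Y.obj (op zz)) : Preaug C :=
  (WithTerminal.lift (Z := op Z) Y.rightOp (fun x => (ε ≫ Y.map (zzTerminal.from x).op).op)
    (fun x y g => by
      change (((ε ≫ Y.map (zzTerminal.from y).op) ≫ Y.map g.op)).op = _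
      rw [Category.assoc, ← Y.map_comp, ← op_comp, zzTerminal.hom_ext (g ≫ _) _])).leftOp

theorem mk_aug (Y : DeltaSqᵒᵖ ⥤ C) (Z : C) (ε : Z ⟶ Y.obj (op zz)) : (mk Y Z ε).aug = ε := by
  change ε ≫ Y.map (zzTerminal.from zz).op = ε
  rw [zzTerminal.hom_ext (zzTerminal.from zz) (𝟙 zz), op_id, Y.map_id, Category.comp_id]

theorem map_star (Y : Preaug C) {y : DeltaSq} (g : WithTerminal.of y ⟶ WithTerminal.star) :
    Y.map g.op = Y.aug ≫ Y.under.map (zzTerminal.from y).op := by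
  have h : g = WithTerminal.incl.map (zzTerminal.from y) ≫ WithTerminal.homFrom zz :=
    Subsingleton.elim _ _
  exact (congrArg (fun g => Y.map (Quiver.Hom.op g)) h).trans (Y.map_comp _ _)

/-- A map of preaugmented bisimplicial objects is given by a map of bisimplicial objects and a
compatible map of augmentations. -/
def homMk {Y Y' : Preaug C} (α : Y.under ⟶ Y'.under) (ζ : Y.augObj ⟶ Y'.augObj)
    (h : Y.aug ≫ α.app (op zz) = ζ ≫ Y'.aug) : Y ⟶ Y' where
  app x := match x with
    | ⟨WithTerminal.of y⟩ => α.app (op y)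
    | ⟨WithTerminal.star⟩ => ζ
  naturality x y g := by
    obtain ⟨x⟩ := x
    obtain ⟨y⟩ := y
    obtain ⟨g, rfl⟩ : ∃ g' : y ⟶ x, g = g'.op := ⟨g.unop, rfl⟩
    match x, y, g with
    | .of x, .of y, g => exact α.naturality (Quiver.Hom.op (WithTerminal.down g))
    | .star, .star, g =>
      obtain rfl : g = 𝟙 _ := Subsingleton.elim _ _
      change Y.map (𝟙 _) ≫ ζ = ζ ≫ Y'.map (𝟙 _)
      rw [Y.map_id, Y'.map_id, Category.id_comp, Category.comp_id]
    | .star, .of y, g =>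
      rw [map_star Y g, map_star Y' g]
      refine (Category.assoc _ _ _).trans ?_
      refine (congrArg (Y.aug ≫ ·) (α.naturality (zzTerminal.from y).op)).trans ?_
      refine (Category.assoc _ _ _).symm.trans ?_
      exact (congrArg (· ≫ Y'.under.map (zzTerminal.from y).op) h).trans (Category.assoc _ _ _)
    | .of x, .star, g => exact (WithTerminal.false_of_from_star g).elim

variable [HasLimitsOfSize.{0, 0} C]

/-- The augmentation `Y_{1,0} ×_{Y_{0,0}} Y_{-1}` of the initial path construction. -/
noncomputable abbrev pathAug (Y : Preaug C) : C :=
  pullback (Y.under.map (Quiver.Hom.op (show zz ⟶ ((j.prod (𝟭 _)).obj zz) from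
    (toJ.app ⦋0⦌, 𝟙 _)))) Y.aug

/-- The initial path construction of a preaugmented bisimplicial object. -/
noncomputable def path (Y : Preaug C) : Preaug C :=
  mk ((j.prod (𝟭 SimplexCategory)).op ⋙ Y.under) Y.pathAug (pullback.fst _ _)

/-- The map `d₀ : P Y ⟶ Y` from the initial path construction. -/
noncomputable def pathD₀ (Y : Preaug C) : Y.path ⟶ Y :=
  homMk
    { app := fun x => Y.under.map (Quiver.Hom.op (show x.unop ⟶ (j.prod (𝟭 _)).obj x.unop from
        (toJ.app x.unop.1, 𝟙 _)))
      naturality := fun x y g => by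
        refine (Y.under.map_comp _ _).symm.trans (Eq.trans ?_ (Y.under.map_comp _ _))
        refine congrArg (fun t => Y.under.map (Quiver.Hom.op t)) ?_
        exact Prod.ext (toJ.naturality g.unop.1).symm
          ((Category.id_comp _).trans (Category.comp_id _).symm) }
    (pullback.snd _ _)
    ((congrArg (· ≫ _) (mk_aug _ _ _)).trans pullback.condition)

end Preaug

variable [HasLimitsOfSize.{0, 0} C]

variable (C) in
/-- The generalized `S_•`-construction: the right adjoint `p_*` of `p^*`, given by right Kan
extension along `p`. -/
noncomputable abbrev genS : Preaug C ⥤ (SimplexCategoryᵒᵖ ⥤ C) := p.op.ran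

variable (C) in
/-- The initial path object of a simplicial object, as a functor. -/
abbrev path : (SimplexCategoryᵒᵖ ⥤ C) ⥤ (SimplexCategoryᵒᵖ ⥤ C) :=
  (Functor.whiskeringLeft _ _ C).obj j.op

/-- The map `d₀ : P X ⟶ X` from the initial path object. -/
def pathD₀ (X : SimplexCategoryᵒᵖ ⥤ C) : (path C).obj X ⟶ X where
  app n := X.map (toJ.app n.unop).op
  naturality m n g := by
    refine (X.map_comp _ _).symm.trans (Eq.trans ?_ (X.map_comp _ _))
    exact congrArg (fun t => X.map (Quiver.Hom.op t)) (toJ.naturality g.unop).symm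

/-- The map `p^* P (S Y) ⟶ P Y` which is adjoint to `P (S Y) ⟶ S (P Y)`. In degree `(k, l)` it is
the projection of `(S Y)_{1 + (k + 1 + l)} = (S Y)_{(1 + k) + 1 + l}` to `Y_{1 + k, l}`; in degree
`-1` it sends `(S Y)_1` to the pair of its components in `Y_{1,0}`, at the vertices `0 ≤ 1 ≤ 1`
of `[1]`, and in `Y_{-1}`, at the vertex `1`. -/
noncomputable def pathComparisonAdj (Y : Preaug C) :
    p.op ⋙ (path C).obj ((genS C).obj Y) ⟶ Y.path :=
  Preaug.homMk
    { app := fun x => ((genS C).obj Y).map (assocJ.app x.unop).op ≫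
        (p.op.ranCounit.app Y).app (op (WithTerminal.of ((j.prod (𝟭 _)).obj x.unop)))
      naturality := fun x y g => by
        refine (Category.assoc _ _ _).symm.trans ?_
        refine Eq.trans ?_ (congrArg (((genS C).obj Y).map (assocJ.app x.unop).op ≫ ·)
          ((p.op.ranCounit.app Y).naturality
            (WithTerminal.incl.map ((j.prod (𝟭 _)).map g.unop)).op) |>.trans
              (Category.assoc _ _ _).symm)
        refine Eq.trans ?_ (Category.assoc _ _ _)
        refine congrArg (· ≫ _) ?_
        refine (((genS C).obj Y).map_comp _ _).symm.trans
          (Eq.trans ?_ (((genS C).obj Y).map_comp _ _))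
        exact congrArg (fun t => ((genS C).obj Y).map (Quiver.Hom.op t))
          (assocJ.naturality g.unop).symm }
    (pullback.lift
      (((genS C).obj Y).map (assocJ.app zz ≫ j.map (p.map (WithTerminal.homFrom zz))).op ≫
        (p.op.ranCounit.app Y).app (op (WithTerminal.of ((j.prod (𝟭 _)).obj zz))))
      (((genS C).obj Y).map (toJ.app ⦋0⦌).op ≫
        (p.op.ranCounit.app Y).app (op WithTerminal.star))
      (by
        have e : joinHom (toJ.app (⦋0⦌ : SimplexCategory)) (𝟙 (⦋0⦌ : SimplexCategory)) ≫
            assocJ.app zz ≫ j.map (p.map (WithTerminal.homFrom zz)) =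
            p.map (WithTerminal.homFrom zz) ≫ toJ.app ⦋0⦌ := by
          refine Eq.trans ?_ (toJ.naturality (p.map (WithTerminal.homFrom zz))).symm
          refine (Category.assoc _ _ _).symm.trans (congrArg (· ≫ _) ?_)
          exact joinHom_inclJ _ _
        refine (Category.assoc _ _ _).trans ?_
        refine Eq.trans ?_ (Category.assoc _ _ _).symm
        refine (congrArg (_ ≫ ·) ((p.op.ranCounit.app Y).naturality (Quiver.Hom.op
          (WithTerminal.incl.map (show zz ⟶ ((j.prod (𝟭 _)).obj zz) from
            (toJ.app ⦋0⦌, 𝟙 _))))).symm).trans ?_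
        refine Eq.trans ?_ (congrArg (_ ≫ ·) ((p.op.ranCounit.app Y).naturality
          (WithTerminal.homFrom zz).op))
        refine (Category.assoc _ _ _).symm.trans (Eq.trans ?_ (Category.assoc _ _ _))
        refine congrArg (· ≫ _) ?_
        refine (((genS C).obj Y).map_comp _ _).symm.trans
          (Eq.trans ?_ (((genS C).obj Y).map_comp _ _))
        exact congrArg (fun t => ((genS C).obj Y).map (Quiver.Hom.op t)) e))
    (by
      refine Eq.trans ?_ (congrArg (_ ≫ ·) (Preaug.mk_aug _ _ _)).symm
      refine Eq.trans ?_ (pullback.lift_fst _ _ _).symm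
      refine (Category.assoc _ _ _).symm.trans (congrArg (· ≫ _) ?_)
      exact (((genS C).obj Y).map_comp _ _).symm)

/-- The comparison `P (S Y) ⟶ S (P Y)`. -/
noncomputable def pathComparison (Y : Preaug C) :
    (path C).obj ((genS C).obj Y) ⟶ (genS C).obj Y.path :=
  (p.op.ranAdjunction C).homEquiv _ _ (pathComparisonAdj Y)

end Preaug

/-! ## Exact nerves and the `S_•`-construction of an exact category -/

/-- The full subgroupoid, spanned by the objects which satisfy `P`, of the maximal subgroupoid
of a category: its morphisms are the isomorphisms. -/
structure IsoFull {C : Type u} [Category.{v} C] (P : ObjectProperty C) : Type u where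
  obj : C
  property : P obj

namespace IsoFull

variable {C : Type u} [Category.{v} C] {P : ObjectProperty C}

instance groupoid : Groupoid.{v} (IsoFull P) where
  Hom X Y := X.obj ≅ Y.obj
  id X := Iso.refl X.obj
  comp a b := a ≪≫ b
  id_comp := Iso.refl_trans
  comp_id := Iso.trans_refl
  assoc := Iso.trans_assoc
  inv a := a.symm
  inv_comp := Iso.symm_self_id
  comp_inv := Iso.self_symm_id

universe v' u'

variable {D : Type u'} [Category.{v'} D] {Q : ObjectProperty D}

/-- The functor between full subgroupoids induced by a functor. -/
def map (T : C ⥤ D) (h : ∀ X, P X → Q (T.obj X)) : IsoFull P ⥤ IsoFull Q where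
  obj X := ⟨T.obj X.obj, h _ X.property⟩
  map {X Y} a := (T.mapIso a : T.obj X.obj ≅ T.obj Y.obj)
  map_id X := T.mapIso_refl X.obj
  map_comp a b := T.mapIso_trans a b

theorem map_congr {T T' : C ⥤ D} (e : T = T') (h : ∀ X, P X → Q (T.obj X))
    (h' : ∀ X, P X → Q (T'.obj X)) : map T h = map T' h' := by
  subst e; rfl

end IsoFull

section Nerve

variable {A : Type u} [Category.{v} A] [Preadditive A] [HasFiniteBiproducts A] [ExactCategory A]
variable {B : Type u} [Category.{v} B] [Preadditive B] [HasFiniteBiproducts B] [ExactCategory B]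

/-- A diagram `F`, indexed by a category `D` whose objects have a row and a column index, in which
all horizontal morphisms (those along a row) are admissible monomorphisms, all vertical morphisms
(those along a column) are admissible epimorphisms, and all squares formed by two horizontal and
two vertical morphisms are bicartesian. -/
structure IsAdmissible {D : Type} [SmallCategory D] {R C : Type} (row : D → R) (col : D → C)
    (F : D ⥤ A) : Prop where
  horizontal : ∀ {x y : D} (a : x ⟶ y), row x = row y → M A (F.map a)
  vertical : ∀ {x y : D} (a : x ⟶ y), col x = col y → E A (F.map a)
  square : ∀ {x y z w : D} (a : x ⟶ y) (b : x ⟶ z) (c : y ⟶ w) (d : z ⟶ w), a ≫ c = b ≫ d →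
    row x = row y → row z = row w → col x = col z → col y = col w →
    Bicartesian (F.map a) (F.map b) (F.map c) (F.map d)

theorem IsAdmissible.comp {D D' : Type} [SmallCategory D] [SmallCategory D'] {R C R' C' : Type}
    {row : D → R} {col : D → C} {row' : D' → R'} {col' : D' → C'} {F : D ⥤ A}
    (hF : IsAdmissible row col F) (G : D' ⥤ D)
    (hr : ∀ x y, row' x = row' y → row (G.obj x) = row (G.obj y))
    (hc : ∀ x y, col' x = col' y → col (G.obj x) = col (G.obj y)) :
    IsAdmissible row' col' (G ⋙ F) where
  horizontal a h := hF.horizontal (G.map a) (hr _ _ h)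
  vertical a h := hF.vertical (G.map a) (hc _ _ h)
  square a b c d sq h₁ h₂ h₃ h₄ := hF.square (G.map a) (G.map b) (G.map c) (G.map d)
    (by rw [← G.map_comp, sq, G.map_comp]) (hr _ _ h₁) (hr _ _ h₂) (hc _ _ h₃) (hc _ _ h₄)

theorem IsAdmissible.map {D : Type} [SmallCategory D] {R C : Type} {row : D → R} {col : D → C}
    {F : D ⥤ A} (hF : IsAdmissible row col F) (f : A ⥤ B) [f.Additive] [IsExactFunctor f] :
    IsAdmissible row col (F ⋙ f) where
  horizontal a h := M_map f _ (hF.horizontal a h)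
  vertical a h := E_map f _ (hF.vertical a h)
  square a b c d sq h₁ h₂ h₃ h₄ := (hF.square a b c d sq h₁ h₂ h₃ h₄).map f
    (hF.horizontal a h₁) (hF.vertical b h₃) (hF.vertical c h₄) (hF.horizontal d h₂)

/-- The category `[n]`. -/
abbrev Ord (n : SimplexCategory) : Type := Fin (n.len + 1)

abbrev ordMap {m n : SimplexCategory} (g : m ⟶ n) : Ord m ⥤ Ord n :=
  g.toOrderHom.monotone.functor

/-- The category `[k] × [l]`. -/
abbrev Grid (x : DeltaSq) : Type := Ord x.1 × Ord x.2

abbrev gridMap {x y : DeltaSq} (g : x ⟶ y) : Grid x ⥤ Grid y :=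
  (ordMap g.1).prod (ordMap g.2)

/-- The category `Ar[n]` of arrows of `[n]`, with objects the pairs `i ≤ j`. -/
abbrev Ar (n : SimplexCategory) : Type := Arrow (Ord n)

abbrev arMap {m n : SimplexCategory} (g : m ⟶ n) : Ar m ⥤ Ar n := (ordMap g).mapArrow

variable (A)

/-- The grids which are objects of the exact nerve in degree `x = (k, l)`: the first coordinate
is the row index and the second one is the column index. -/
def gridProp (x : DeltaSq) : ObjectProperty (Grid x ⥤ A) :=
  fun F => IsAdmissible Prod.fst Prod.snd F

/-- The bisimplicial groupoid underlying the exact nerve. -/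
def nerveBisimplicial : DeltaSqᵒᵖ ⥤ Grpd.{v, max v u} where
  obj x := Grpd.of (IsoFull (gridProp A x.unop))
  map {x y} g := (IsoFull.map ((Functor.whiskeringLeft _ _ A).obj (gridMap g.unop))
    (fun _ hF => hF.comp _ (fun _ _ h => congrArg g.unop.1.toOrderHom h)
      (fun _ _ h => congrArg g.unop.2.toOrderHom h)) :
      IsoFull (gridProp A x.unop) ⥤ IsoFull (gridProp A y.unop))
  map_id _ := rfl
  map_comp _ _ := rfl

/-- Zero objects of `A`, as diagrams of shape `[0] × [0]`. -/
def zeroProp : ObjectProperty (Grid zz ⥤ A) := fun F => ∀ x, IsZero (F.obj x)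

variable {A} in
theorem gridProp_of_zero {F : Grid zz ⥤ A} (h : zeroProp A F) : gridProp A zz F := by
  have hi {x y : Grid zz} (a : x ⟶ y) : IsIso (F.map a) := by
    rw [(h x).eq_of_src (F.map a) ((h x).iso (h y)).hom]
    infer_instance
  have w {x y z : Grid zz} (a : F.obj x ⟶ F.obj y) (b : F.obj y ⟶ F.obj z) : a ≫ b = 0 :=
    (h x).eq_of_src _ _
  have := @hi
  refine ⟨fun {x y} a _ => ⟨F.obj y, 0, w _ _, seq_of_isZero _ (h _) (h _) (h _)⟩,
    fun {x y} a _ => ⟨F.obj x, 0, w _ _, seq_of_isZero _ (h _) (h _) (h _)⟩,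
    fun a b c d sq _ _ _ _ => ?_⟩
  have sq' : CommSq (F.map a) (F.map b) (F.map c) (F.map d) :=
    ⟨by rw [← F.map_comp, sq, F.map_comp]⟩
  exact ⟨IsPullback.of_horiz_isIso sq', IsPushout.of_horiz_isIso sq'⟩

/-- The exact nerve. Its augmentation is the groupoid of zero objects of `A`, regarded, like
`(N^e A)_{0,0} = A_iso`, as a groupoid of diagrams of shape `[0] × [0]`. -/
def exactNerve : Preaug Grpd.{v, max v u} :=
  Preaug.mk (nerveBisimplicial A) (Grpd.of (IsoFull (zeroProp A)))
    (IsoFull.map (𝟭 _) (fun _ h => gridProp_of_zero h) :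
      IsoFull (zeroProp A) ⥤ IsoFull (gridProp A zz))

/-- The diagrams of shape `Ar[n]` with admissible monomorphisms along the rows, admissible
epimorphisms along the columns, bicartesian squares and zero objects on the diagonal. -/
def arProp (n : SimplexCategory) : ObjectProperty (Ar n ⥤ A) :=
  fun F => IsAdmissible (fun x => x.left) (fun x => x.right) F ∧
    ∀ x : Ar n, x.left = x.right → IsZero (F.obj x)

/-- The `S_•`-construction `S_•^e(A)` of an exact category, with arbitrary zero objects on the
diagonal. -/
def exactS : SimplexCategoryᵒᵖ ⥤ Grpd.{v, max v u} where
  obj n := Grpd.of (IsoFull (arProp A n.unop))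
  map {m n} g := (IsoFull.map ((Functor.whiskeringLeft _ _ A).obj (arMap g.unop))
    (fun _ hF => ⟨hF.1.comp _ (fun _ _ h => congrArg g.unop.toOrderHom h)
      (fun _ _ h => congrArg g.unop.toOrderHom h),
      fun _ h => hF.2 _ (congrArg g.unop.toOrderHom h)⟩) :
      IsoFull (arProp A m.unop) ⥤ IsoFull (arProp A n.unop))
  map_id _ := rfl
  map_comp _ _ := rfl

variable {A}

section

variable (f : A ⥤ B) [f.Additive] [IsExactFunctor f]

/-- The map `N^e f`. -/
def exactNerveMap : exactNerve A ⟶ exactNerve B :=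
  Preaug.homMk
    { app := fun x => (IsoFull.map ((Functor.whiskeringRight _ _ _).obj f) (fun _ h => h.map f) :
        IsoFull (gridProp A x.unop) ⥤ IsoFull (gridProp B x.unop))
      naturality := fun _ _ _ => rfl }
    (IsoFull.map ((Functor.whiskeringRight _ _ _).obj f) (fun _ h x => f.map_isZero (h x)) :
        IsoFull (zeroProp A) ⥤ IsoFull (zeroProp B))
    rfl

/-- The map `S_•^e(f)`. -/
def exactSMap : exactS A ⟶ exactS B where
  app n := (IsoFull.map ((Functor.whiskeringRight _ _ _).obj f)
      (fun _ h => ⟨h.1.map f, fun x hx => f.map_isZero (h.2 x hx)⟩) :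
      IsoFull (arProp A n.unop) ⥤ IsoFull (arProp B n.unop))
  naturality := fun _ _ _ => rfl

/-- The relative `S_•`-construction `S_•^rel(f)`, a pullback of simplicial groupoids. -/
noncomputable abbrev relS : SimplexCategoryᵒᵖ ⥤ Grpd.{v, max v u} :=
  pullback (pathD₀ (exactS B)) (exactSMap f)

/-- The relative exact nerve `N^rel f`, a pullback of preaugmented bisimplicial groupoids. -/
noncomputable abbrev relNerve : Preaug Grpd.{v, max v u} :=
  pullback (exactNerve B).pathD₀ (exactNerveMap f)

end

/-- The functor `[k] × [l] ⥤ Ar[k + 1 + l]`, which sends `(a, b)` to `a ≤ k + 1 + b`. -/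
def gridToAr (x : DeltaSq) : Grid x ⥤ Ar (join.obj x) where
  obj y := Arrow.mk (homOfLE (show (⟨y.1.val, by omega⟩ : Fin (x.1.len + x.2.len + 1 + 1)) ≤
    ⟨x.1.len + 1 + y.2.val, by omega⟩ from Fin.mk_le_mk.2 (by omega)))
  map {y z} g := Arrow.homMk
    (homOfLE (Fin.mk_le_mk.2 (by have : y.1.val ≤ z.1.val := leOfHom g.1; omega)))
    (homOfLE (Fin.mk_le_mk.2 (by have : y.2.val ≤ z.2.val := leOfHom g.2; omega)))
    (Subsingleton.elim _ _)

theorem ar_ext {n : SimplexCategory} {x y : Ar n} (hl : x.left = y.left)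
    (hr : x.right = y.right) : x = y := by
  obtain ⟨a, b, c⟩ := x
  obtain ⟨a', b', c'⟩ := y
  obtain rfl : a = a' := hl
  obtain rfl : b = b' := hr
  obtain rfl : c = c' := Subsingleton.elim (α := (a : Ord n) ⟶ b) c c'
  rfl

theorem ar_hom_ext {n : SimplexCategory} {x y : Ar n} (a b : x ⟶ y) : a = b :=
  Arrow.hom_ext _ _ (Subsingleton.elim _ _) (Subsingleton.elim _ _)

/-- The functor `[0] × [0] ⥤ Ar[0]`. -/
def zzToAr : Grid zz ⥤ Ar ⦋0⦌ := gridToAr zz ⋙ arMap (p.map (WithTerminal.homFrom zz))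

theorem gridToAr_naturality {x y : DeltaSq} (g : x ⟶ y) :
    gridToAr x ⋙ arMap (join.map g) = gridMap g ⋙ gridToAr y :=
  CategoryTheory.Functor.ext
    (fun z => ar_ext (Fin.ext (joinHom_left g.1 g.2 _ z.1 rfl))
      (Fin.ext (joinHom_right g.1 g.2 _ z.2 rfl)))
    (fun _ _ _ => ar_hom_ext _ _)

variable (A)

/-- Restriction of diagrams of shape `Ar[k + 1 + l]` to `[k] × [l]`. -/
def arToGrid (x : DeltaSq) : IsoFull (arProp A (join.obj x)) ⥤ IsoFull (gridProp A x) :=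
  IsoFull.map ((Functor.whiskeringLeft _ _ A).obj (gridToAr x))
    (fun _ hF => hF.1.comp _
      (fun _ _ h => Fin.ext (congrArg (fun t : Ord x.1 => t.val) h))
      (fun _ _ h => Fin.ext (congrArg (fun t : Ord x.2 => x.1.len + 1 + t.val) h)))

/-- The value of a diagram of shape `Ar[0]`. -/
def arToZero : IsoFull (arProp A ⦋0⦌) ⥤ IsoFull (zeroProp A) :=
  IsoFull.map ((Functor.whiskeringLeft _ _ A).obj zzToAr)
    (fun _ hF _ => hF.2 _ (Subsingleton.elim (α := Fin 1) _ _))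

/-- The map `p^* S_•^e(A) ⟶ N^e A` which is adjoint to the comparison map. -/
def comparisonAdj : p.op ⋙ exactS A ⟶ exactNerve A :=
  Preaug.homMk
    { app := fun x => arToGrid A x.unop
      naturality := fun x y g => IsoFull.map_congr (P := arProp A (join.obj x.unop))
        (Q := gridProp A y.unop) (congrArg (fun G => (Functor.whiskeringLeft _ _ A).obj G)
          (gridToAr_naturality g.unop))
        (fun X hX => (((exactS A).map (join.map g.unop).op ⋙ arToGrid A y.unop).obj
          ⟨X, hX⟩).property)
        (fun X hX => ((arToGrid A x.unop ⋙ (nerveBisimplicial A).map g).obj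
          ⟨X, hX⟩).property) }
    (arToZero A)
    rfl

/-- The comparison map `S_•^e(A) ⟶ S_•(N^e A)`. -/
noncomputable def comparison : exactS A ⟶ (genS _).obj (exactNerve A) :=
  (p.op.ranAdjunction _).homEquiv _ _ (comparisonAdj A)

end Nerve

end Sdot

namespace Sdot

/-! ## Surjective equivalences of groupoids -/

section TrivFib

/-! The right Kan extension along `p` is pointwise, so `S_m(Y)` is a strict limit of groupoids,
indexed by the maps `[q+1+r] ⟶ [m]` and the vertices `[0] ⟶ [m]`. An object is a strictly compatible
family of objects of the `Y_{q,r}` and of `Y_{-1}`, and the adjunct of a map `p^* X ⟶ Y` is a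
functor into this limit (`adjFunctor`).

For `Y = N^e A`, a map `[q+1+r] ⟶ [m]` names a grid in `Ar[m]`. Every rectangle `i ≤ i' ≤ j ≤ j'` is
such a grid. A morphism of `Ar[m]` that fits in no rectangle is a horizontal morphism followed by a
vertical one, and each of these does fit. Admissibility concerns only horizontal morphisms, vertical
morphisms and the squares they form, so it too is tested on rectangles; the vertices account for the
zero objects on the diagonal. Hence compatible families of grids are the same as diagrams on
`Ar[m]`, and `c` is bijective on objects and morphisms (`isIso_adjFunctor_comparisonAdj`).

For `P N^e B` the grids carry an additional initial row. Together they cover all of `Ar([0] ⋆ [m])`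
except the point `(0, 0)`, where a diagram in `P S^e(B)` has a zero object. Restriction to the grids
forgets this choice of zero object and nothing else: it is surjective on objects and fully faithful,
though not injective on objects (`isTrivFib_adjFunctor_pathAdj`). Both cases use one gluing argument
with a cutoff `c ≤ 1` on the column index: `c = 0` for `N^e A`, and `c = 1` when `(0, 0)` is
missing. Since `P(c_B)` is invertible, the statement about `φ` follows.

Finally `S_•` is a right adjoint and preserves the pullback defining `N^rel f`. The maps `c` are
natural and `φ` is compatible with `d₀`, so the pasting law exhibits `w` as a base change of `φ ∘
P(c_B)` (`exists_relComparison`). Functors that are surjective on objects and fully faithful are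
stable under strict pullback, so `w` is one in each degree. -/

theorem eqToHom_conj_injective {C : Type u} [Category.{v} C] {x y x' y' : C} {a b : x ⟶ y}
    (h₁ : x' = x) (h₂ : y = y') (h : eqToHom h₁ ≫ a ≫ eqToHom h₂ = eqToHom h₁ ≫ b ≫ eqToHom h₂) :
    a = b := by
  subst h₁ h₂
  simpa using h

/-- A functor of groupoids which is surjective on objects and fully faithful. -/
structure IsTrivFib {X Y : Grpd.{v, u}} (G : X ⟶ Y) : Prop where
  surj : ∀ y : Y, ∃ x : X, G.obj x = y
  full : ∀ {x x' : X} (b : G.obj x ⟶ G.obj x'), ∃ a : x ⟶ x', G.map a = b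
  faithful : ∀ {x x' : X} (a a' : x ⟶ x'), G.map a = G.map a' → a = a'

namespace IsTrivFib

variable {X Y Z : Grpd.{v, u}}

theorem isEquivalence {G : X ⟶ Y} (h : IsTrivFib G) : Functor.IsEquivalence G where
  faithful := ⟨fun {_ _ a a'} e => h.faithful a a' e⟩
  full := ⟨fun {_ _} b => h.full b⟩
  essSurj := ⟨fun y => by
    obtain ⟨x, hx⟩ := h.surj y
    exact ⟨x, ⟨eqToIso hx⟩⟩⟩

/-- The target of the isomorphism is on the nose the image of an object, so fullness alone gives the
lift. -/
theorem isIsofibration {G : X ⟶ Y} (h : IsTrivFib G) : IsIsofibration G := by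
  intro x y e
  obtain ⟨x', rfl⟩ := h.surj y
  obtain ⟨a, ha⟩ := h.full e
  exact ⟨x', a, rfl, by rw [ha, eqToHom_refl, Category.comp_id]⟩

theorem comp {G : X ⟶ Y} {H : Y ⟶ Z} (hG : IsTrivFib G) (hH : IsTrivFib H) :
    IsTrivFib (G ≫ H) where
  surj z := by
    obtain ⟨y, rfl⟩ := hH.surj z
    obtain ⟨x, rfl⟩ := hG.surj y
    exact ⟨x, rfl⟩
  full b := by
    obtain ⟨b', rfl⟩ := hH.full b
    obtain ⟨a, rfl⟩ := hG.full b'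
    exact ⟨a, rfl⟩
  faithful a a' e := hG.faithful _ _ (hH.faithful _ _ e)

theorem of_isIso (G : X ⟶ Y) [IsIso G] : IsTrivFib G := by
  have e₁ : G ⋙ inv G = 𝟭 X := IsIso.hom_inv_id G
  have e₂ : (inv G : Y ⥤ X) ⋙ G = 𝟭 Y := IsIso.inv_hom_id G
  have hf {x x' : X} (a a' : x ⟶ x') (h : G.map a = G.map a') : a = a' := by
    have h₁ := Functor.congr_hom e₁ a
    have h₂ := Functor.congr_hom e₁ a'
    simp only [Functor.comp_map, h, Functor.id_map] at h₁ h₂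
    rw [h₁] at h₂
    exact eqToHom_conj_injective _ _ h₂
  have hf' {x x' : Y} (a a' : x ⟶ x') (h : (inv G).map a = (inv G).map a') : a = a' := by
    have h₁ := Functor.congr_hom e₂ a
    have h₂ := Functor.congr_hom e₂ a'
    simp only [Functor.comp_map, h, Functor.id_map] at h₁ h₂
    rw [h₁] at h₂
    exact eqToHom_conj_injective _ _ h₂
  refine ⟨fun y => ⟨(inv G).obj y, Functor.congr_obj e₂ y⟩, fun {x x'} b => ?_, hf⟩
  -- The preimage is `inv G` applied to `b`, conjugated back along `G ≫ inv G = 𝟙`. The equation is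
  -- checked after applying `inv G`, which is faithful for the same reason as `G`.
  refine ⟨eqToHom (Functor.congr_obj e₁ x).symm ≫ (inv G).map b ≫
    eqToHom (Functor.congr_obj e₁ x'), hf' _ _ ?_⟩
  have h₁ := Functor.congr_hom e₁ (eqToHom (Functor.congr_obj e₁ x).symm ≫ (inv G).map b ≫
    eqToHom (Functor.congr_obj e₁ x'))
  refine h₁.trans ?_
  simp

theorem injective_of_isIso (G : X ⟶ Y) [IsIso G] {x x' : X} (h : G.obj x = G.obj x') :
    x = x' := by
  have e₁ : G ⋙ inv G = 𝟭 X := IsIso.hom_inv_id G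
  exact (Functor.congr_obj e₁ x).symm.trans ((congrArg (inv G).obj h).trans
    (Functor.congr_obj e₁ x'))

/-- Choosing preimages of objects and morphisms defines the inverse. Faithfulness of `G` makes it a
functor, and injectivity on objects makes it a strict inverse rather than a quasi-inverse. -/
theorem isIso {G : X ⟶ Y} (h : IsTrivFib G) (hi : ∀ x x' : X, G.obj x = G.obj x' → x = x') :
    IsIso G := by
  choose s hs using h.surj
  have hfull (x x' : X) (b : G.obj x ⟶ G.obj x') : ∃ a : x ⟶ x', G.map a = b := h.full b
  choose t ht using hfull
  let S : Y ⥤ X :=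
    { obj := s
      map := fun {y y'} b => t _ _ (eqToHom (hs y) ≫ b ≫ eqToHom (hs y').symm)
      map_id := fun y => h.faithful _ _ (by rw [ht]; simp)
      map_comp := fun b b' => h.faithful _ _ (by rw [ht, Functor.map_comp, ht, ht]; simp) }
  refine ⟨S, ?_, ?_⟩
  · refine CategoryTheory.Functor.ext (F := G ⋙ S) (G := 𝟭 X)
      (fun x => hi _ _ (hs (G.obj x))) (fun x y a => h.faithful _ _ ?_)
    change G.map (t _ _ _) = _
    rw [ht]
    simp [eqToHom_map]
  · refine CategoryTheory.Functor.ext (F := S ⋙ G) (G := 𝟭 Y) (fun y => hs y) (fun x y a => ?_)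
    exact ht _ _ _

theorem of_comp_isIso {G : X ⟶ Y} {H : Y ⟶ Z} [IsIso H] (h : IsTrivFib (G ≫ H)) :
    IsTrivFib G := by
  have := h.comp (of_isIso (inv H))
  rwa [Category.assoc, IsIso.hom_inv_id, Category.comp_id] at this

theorem of_isIso_comp {G : X ⟶ Y} {H : Y ⟶ Z} [IsIso G] (h : IsTrivFib (G ≫ H)) :
    IsTrivFib H := by
  have := (of_isIso (inv G)).comp h
  rwa [← Category.assoc, IsIso.inv_hom_id, Category.id_comp] at this

end IsTrivFib

/-- Through this isomorphism the abstract limits below, pullbacks and pointwise Kan extensions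
alike, are computed as strictly compatible families. -/
theorem GrpdLimit.isIso_lift {J : Type} [SmallCategory J] {F : J ⥤ Grpd.{v, u}} {c : Cone F}
    (hc : IsLimit c) : IsIso (show c.pt ⟶ Grpd.of (GrpdLimit F) from GrpdLimit.lift F c) :=
  (hc.conePointUniqueUpToIso (GrpdLimit.isLimit F)).isIso_hom

/-! ### Strict pullbacks of groupoids -/

section Pullback

variable {P X W Z : Grpd.{v, u}} {s : P ⟶ X} {t : P ⟶ W} {g : X ⟶ Z} {h : W ⟶ Z}

/-- Two objects with the same image in the base come from an object of the pullback. -/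
theorem IsPullback.exists_obj (pb : IsPullback s t g h) (x : X) (w : W)
    (e : g.obj x = h.obj w) : ∃ p : P, s.obj p = x ∧ t.obj p = w := by
  have := GrpdLimit.isIso_lift pb.isLimit
  let q : GrpdLimit (cospan g h) :=
    { obj := fun i => match i with
        | none => h.obj w
        | some WalkingPair.left => x
        | some WalkingPair.right => w
      compat := fun {i k} f => by
        match i, k, f with
        | _, _, WidePullbackShape.Hom.id none => rfl
        | _, _, WidePullbackShape.Hom.id (some WalkingPair.left) => rfl
        | _, _, WidePullbackShape.Hom.id (some WalkingPair.right) => rfl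
        | _, _, WidePullbackShape.Hom.term WalkingPair.left => exact e
        | _, _, WidePullbackShape.Hom.term WalkingPair.right => rfl }
  obtain ⟨p, hp⟩ := (IsTrivFib.of_isIso (show _ ⟶ Grpd.of (GrpdLimit (cospan g h)) from
    GrpdLimit.lift _ pb.cone)).surj q
  exact ⟨p, congrArg (fun z : GrpdLimit (cospan g h) => z.obj WalkingCospan.left) hp,
    congrArg (fun z : GrpdLimit (cospan g h) => z.obj WalkingCospan.right) hp⟩

theorem IsPullback.obj_ext (pb : IsPullback s t g h) {p q : P} (e₁ : s.obj p = s.obj q)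
    (e₂ : t.obj p = t.obj q) : p = q := by
  have := GrpdLimit.isIso_lift pb.isLimit
  refine IsTrivFib.injective_of_isIso (show _ ⟶ Grpd.of (GrpdLimit (cospan g h)) from
    GrpdLimit.lift _ pb.cone) (GrpdLimit.obj_ext fun i => ?_)
  match i with
  | none => exact congrArg g.obj e₁
  | some WalkingPair.left => exact e₁
  | some WalkingPair.right => exact e₂

theorem IsPullback.map_ext (pb : IsPullback s t g h) {p q : P} {a b : p ⟶ q}
    (e₁ : s.map a = s.map b) (e₂ : t.map a = t.map b) : a = b := by
  have := GrpdLimit.isIso_lift pb.isLimit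
  refine (IsTrivFib.of_isIso (show _ ⟶ Grpd.of (GrpdLimit (cospan g h)) from
    GrpdLimit.lift _ pb.cone)).faithful _ _ (GrpdLimit.hom_ext fun i => ?_)
  match i with
  | none => exact congrArg g.map e₁
  | some WalkingPair.left => exact e₁
  | some WalkingPair.right => exact e₂

theorem IsPullback.exists_map (pb : IsPullback s t g h) {p q : P} (a : s.obj p ⟶ s.obj q)
    (b : t.obj p ⟶ t.obj q) (e : g.map a = eqToHom (Functor.congr_obj pb.w p) ≫ h.map b ≫
      eqToHom (Functor.congr_obj pb.w q).symm) :
    ∃ c : p ⟶ q, s.map c = a ∧ t.map c = b := by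
  let L : P ⟶ Grpd.of (GrpdLimit (cospan g h)) := GrpdLimit.lift _ pb.cone
  have : IsIso L := GrpdLimit.isIso_lift pb.isLimit
  let φ : GrpdLimit.Hom (F := cospan g h) (L.obj p) (L.obj q) :=
    { app := fun i => match i with
        | none => g.map a
        | some WalkingPair.left => a
        | some WalkingPair.right => b
      compat := fun {i k} f => by
        match i, k, f with
        | _, _, WidePullbackShape.Hom.id none =>
          exact ((Category.id_comp _).trans (Category.comp_id _)).symm
        | _, _, WidePullbackShape.Hom.id (some WalkingPair.left) =>
          exact ((Category.id_comp _).trans (Category.comp_id _)).symm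
        | _, _, WidePullbackShape.Hom.id (some WalkingPair.right) =>
          exact ((Category.id_comp _).trans (Category.comp_id _)).symm
        | _, _, WidePullbackShape.Hom.term WalkingPair.left =>
          exact ((Category.id_comp _).trans (Category.comp_id _)).symm
        | _, _, WidePullbackShape.Hom.term WalkingPair.right =>
          exact GrpdLimit.eq_conj _ _ _ _ e _ _ }
  obtain ⟨c, hc⟩ := (IsTrivFib.of_isIso L).full (x := p) (x' := q) φ
  exact ⟨c, congrArg (fun z : GrpdLimit.Hom (F := cospan g h) (L.obj p) (L.obj q) =>
    z.app WalkingCospan.left) hc, congrArg (fun z : GrpdLimit.Hom (F := cospan g h) (L.obj p)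
    (L.obj q) => z.app WalkingCospan.right) hc⟩

/-- An object or morphism of `W` has its image in `Z` lifted along `g`. The lift agrees with it
strictly over `Z`, up to transport along the equality of the two composites, so the pair belongs to
the pullback. -/
theorem IsTrivFib.of_isPullback (pb : IsPullback s t g h) (hg : IsTrivFib g) : IsTrivFib t where
  surj w := by
    obtain ⟨x, hx⟩ := hg.surj (h.obj w)
    obtain ⟨p, -, hp⟩ := IsPullback.exists_obj pb x w hx
    exact ⟨p, hp⟩
  full {p q} b := by
    obtain ⟨a, ha⟩ := hg.full (x := s.obj p) (x' := s.obj q)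
      (eqToHom (Functor.congr_obj pb.w p) ≫ h.map b ≫ eqToHom (Functor.congr_obj pb.w q).symm)
    obtain ⟨c, -, hc⟩ := IsPullback.exists_map pb a b ha
    exact ⟨c, hc⟩
  faithful {p q} a b e := by
    refine IsPullback.map_ext pb (hg.faithful _ _ ?_) e
    exact (Functor.congr_hom pb.w a).trans (Eq.trans (by
      rw [show (t ≫ h).map a = (t ≫ h).map b from congrArg h.map e])
      (Functor.congr_hom pb.w b).symm)

/-- This and the next lemma pass from the augmentation of the exact nerve to that of its path
construction, which is a base change of it. -/
theorem IsPullback.fst_obj_injective (pb : IsPullback s t g h)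
    (hh : ∀ w w' : W, h.obj w = h.obj w' → w = w') {p q : P} (e : s.obj p = s.obj q) : p = q :=
  IsPullback.obj_ext pb e (hh _ _ ((Functor.congr_obj pb.w p).symm.trans
    ((congrArg g.obj e).trans (Functor.congr_obj pb.w q))))

theorem IsPullback.fst_map_injective (pb : IsPullback s t g h)
    (hh : ∀ (w w' : W) (a b : w ⟶ w'), h.map a = h.map b → a = b) {p q : P} {a b : p ⟶ q}
    (e : s.map a = s.map b) : a = b := by
  refine IsPullback.map_ext pb e (hh _ _ _ _ ?_)
  refine eqToHom_conj_injective (Functor.congr_obj pb.w p) (Functor.congr_obj pb.w q).symm ?_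
  exact (Functor.congr_hom pb.w a).symm.trans ((congrArg g.map e).trans
    (Functor.congr_hom pb.w b))

end Pullback

end TrivFib

/-! ## The generalized construction in terms of explicit limits -/

section GenS

variable {X : SimplexCategoryᵒᵖ ⥤ Grpd.{v, u}} {Y : Preaug Grpd.{v, u}}

/-- The diagram whose limit is the generalized construction in degree `n`. -/
abbrev genDiagram (Y : Preaug Grpd.{v, u}) (n : SimplexCategoryᵒᵖ) :
    StructuredArrow n p.op ⥤ Grpd.{v, u} :=
  StructuredArrow.proj n p.op ⋙ Y

/-- The cone on `genDiagram Y n` given by a map `p^* X ⟶ Y`. -/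
def adjCone (β : p.op ⋙ X ⟶ Y) (n : SimplexCategoryᵒᵖ) : Cone (genDiagram Y n) :=
  (Functor.RightExtension.mk X β).coneAt n

/-- The functor from `X_n` to the explicit limit given by a map `p^* X ⟶ Y`. -/
def adjFunctor (β : p.op ⋙ X ⟶ Y) (n : SimplexCategoryᵒᵖ) :
    X.obj n ⟶ Grpd.of (GrpdLimit (genDiagram Y n)) :=
  GrpdLimit.lift _ (adjCone β n)

theorem whisker_homEquiv_counit (β : p.op ⋙ X ⟶ Y) :
    Functor.whiskerLeft p.op ((p.op.ranAdjunction _).homEquiv X Y β) ≫ p.op.ranCounit.app Y = β := by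
  have := ((p.op.ranAdjunction Grpd.{v, u}).homEquiv X Y).symm_apply_apply β
  rw [Adjunction.homEquiv_counit, Functor.ranAdjunction_counit] at this
  exact this

/-- The adjunct of a map `p^* X ⟶ Y` is, up to isomorphism, the functor into the explicit limit. -/
theorem exists_isIso_adjunct (β : p.op ⋙ X ⟶ Y) (n : SimplexCategoryᵒᵖ) :
    ∃ e : ((genS _).obj Y).obj n ⟶ Grpd.of (GrpdLimit (genDiagram Y n)), IsIso e ∧
      ((p.op.ranAdjunction _).homEquiv X Y β).app n ≫ e = adjFunctor β n := by
  -- `e` compares two limits of the same diagram: the value of the pointwise Kan extension and the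
  -- explicit one. The components at `k` then agree by naturality and the triangle identity.
  refine ⟨_, GrpdLimit.isIso_lift (p.op.isPointwiseRightKanExtensionRanCounit Y n), ?_⟩
  refine (GrpdLimit.isLimit (genDiagram Y n)).hom_ext fun k => ?_
  change ((p.op.ranAdjunction _).homEquiv X Y β).app n ≫ ((genS _).obj Y).map k.hom ≫
    (p.op.ranCounit.app Y).app k.right = X.map k.hom ≫ β.app k.right
  rw [← NatTrans.naturality_assoc]
  exact congrArg (X.map k.hom ≫ ·) (NatTrans.congr_app (whisker_homEquiv_counit β) k.right)

theorem isTrivFib_adjunct {β : p.op ⋙ X ⟶ Y} {n : SimplexCategoryᵒᵖ}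
    (h : IsTrivFib (adjFunctor β n)) :
    IsTrivFib (((p.op.ranAdjunction _).homEquiv X Y β).app n) := by
  obtain ⟨e, he, w⟩ := exists_isIso_adjunct β n
  exact IsTrivFib.of_comp_isIso (H := e) (by rwa [w])

theorem isIso_adjunct {β : p.op ⋙ X ⟶ Y} {n : SimplexCategoryᵒᵖ}
    (h : IsIso (adjFunctor β n)) :
    IsIso (((p.op.ranAdjunction _).homEquiv X Y β).app n) := by
  obtain ⟨e, he, w⟩ := exists_isIso_adjunct β n
  have : IsIso (((p.op.ranAdjunction _).homEquiv X Y β).app n ≫ e) := by rwa [w]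
  exact IsIso.of_isIso_comp_right _ e

end GenS

/-! ## Functors in terms of equalities of arrows -/

section Arrows

variable {C : Type u} [Category.{v} C]

/-- An equation in `Arrow C` includes the equality of the endpoints. Gluing is carried out in that
form; this lemma and the next translate to and from conjugation by `eqToHom`. -/
theorem eq_conj_of_arrow_eq {x y x' y' : C} {f : x ⟶ y} {g : x' ⟶ y'}
    (h : Arrow.mk f = Arrow.mk g) (h₁ : x = x') (h₂ : y' = y) :
    f = eqToHom h₁ ≫ g ≫ eqToHom h₂ := by
  subst h₁ h₂
  simpa using Arrow.mk_injective _ _ h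

theorem arrow_eq_of_eq_conj {x y x' y' : C} {f : x ⟶ y} {g : x' ⟶ y'} (h₁ : x = x')
    (h₂ : y' = y) (h : f = eqToHom h₁ ≫ g ≫ eqToHom h₂) : Arrow.mk f = Arrow.mk g := by
  subst h₁ h₂ h
  simp

theorem functor_eq_of_arrow_eq {D : Type*} [Category* D] {F G : D ⥤ C}
    (h : ∀ {x y : D} (a : x ⟶ y), Arrow.mk (F.map a) = Arrow.mk (G.map a)) : F = G := by
  have e (x : D) : F.obj x = G.obj x := congrArg Comma.left (h (𝟙 x))
  exact CategoryTheory.Functor.ext e fun x y a => eq_conj_of_arrow_eq (h a) (e x) (e y).symm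

theorem arrow_map_eq {D : Type*} [Category* D] {F G : D ⥤ C} (h : F = G) {x y : D} (a : x ⟶ y) :
    Arrow.mk (F.map a) = Arrow.mk (G.map a) := by
  subst h; rfl

/-- The arrow `w` is the composite of `u` and `v`. -/
def IsComp (u v w : Arrow C) : Prop :=
  ∃ h : u.right = v.left, w = Arrow.mk (u.hom ≫ eqToHom h ≫ v.hom)

theorem isComp_mk {x y z : C} (f : x ⟶ y) (g : y ⟶ z) :
    IsComp (Arrow.mk f) (Arrow.mk g) (Arrow.mk (f ≫ g)) :=
  ⟨rfl, by simp⟩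

theorem IsComp.unique {u v w w' : Arrow C} (h : IsComp u v w) (h' : IsComp u v w') : w = w' :=
  h.2.trans h'.2.symm

/-- The composite is `(h₁ v₁)(h₂ v₂) = h₁ (v₁ h₂) v₂ = h₁ (h' v') v₂ = (h₁ h')(v' v₂)`. The exchange
`v₁ h₂ = h' v'` is what makes horizontal-then-vertical factorizations multiply. -/
theorem IsComp.paste {h₁ v₁ r₁ h₂ v₂ r₂ s h' v' h₃ v₃ r₃ : Arrow C} (a₁ : IsComp h₁ v₁ r₁)
    (a₂ : IsComp h₂ v₂ r₂) (b₁ : IsComp v₁ h₂ s) (b₂ : IsComp h' v' s) (c₁ : IsComp h₁ h' h₃)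
    (c₂ : IsComp v' v₂ v₃) (d : IsComp h₃ v₃ r₃) : IsComp r₁ r₂ r₃ := by
  obtain ⟨x₀, x₁, f₁⟩ := h₁
  obtain ⟨x₁', x₂, g₁⟩ := v₁
  obtain ⟨x₂', x₃, f₂⟩ := h₂
  obtain ⟨x₃', x₄, g₂⟩ := v₂
  obtain ⟨y₁, y, f'⟩ := h'
  obtain ⟨y', y₂, g'⟩ := v'
  obtain ⟨e₁, rfl⟩ := a₁
  obtain rfl : x₁ = x₁' := e₁
  obtain ⟨e₂, rfl⟩ := a₂
  obtain rfl : x₃ = x₃' := e₂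
  obtain ⟨e₃, rfl⟩ := b₁
  obtain rfl : x₂ = x₂' := e₃
  obtain ⟨e₄, e⟩ := b₂
  obtain rfl : y = y' := e₄
  obtain ⟨e₅, rfl⟩ := c₁
  obtain rfl : x₁ = y₁ := e₅
  obtain ⟨e₆, rfl⟩ := c₂
  obtain rfl : y₂ = x₃ := e₆
  obtain ⟨-, rfl⟩ := d
  refine ⟨rfl, ?_⟩
  have e' := Arrow.mk_injective _ _ e
  simp only [eqToHom_refl, Category.id_comp] at e'
  simp only [Arrow.mk_hom, eqToHom_refl, Category.id_comp, Category.assoc, ← Category.assoc g₁, e']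

/-- Objects are read off from the arrows assigned to identities. Composability of `R a` with those
arrows on either side shows that `R a` has the right source and target. -/
theorem exists_functor_of_arrows {D : Type*} [Category* D] (R : ∀ {x y : D}, (x ⟶ y) → Arrow C)
    (hid : ∀ x : D, ∃ X : C, R (𝟙 x) = Arrow.mk (𝟙 X))
    (hcomp : ∀ {x y z : D} (a : x ⟶ y) (b : y ⟶ z), IsComp (R a) (R b) (R (a ≫ b))) :
    ∃ F : D ⥤ C, ∀ {x y : D} (a : x ⟶ y), Arrow.mk (F.map a) = R a := by
  choose ob hob using hid
  have hl {x y : D} (a : x ⟶ y) : ob x = (R a).left := by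
    obtain ⟨h, -⟩ := hcomp (𝟙 x) a
    exact (congrArg Comma.right (hob x)).symm.trans h
  have hr {x y : D} (a : x ⟶ y) : (R a).right = ob y := by
    obtain ⟨h, -⟩ := hcomp a (𝟙 y)
    exact h.trans (congrArg Comma.left (hob y))
  refine ⟨{ obj := ob, map := fun a => eqToHom (hl a) ≫ (R a).hom ≫ eqToHom (hr a),
            map_id := fun x => ?_, map_comp := fun {x y z} a b => ?_ }, fun {x y} a => ?_⟩
  · refine (eq_conj_of_arrow_eq (g := (R (𝟙 x)).hom) (hob x).symm _ _).symm
  · obtain ⟨h, e⟩ := hcomp a b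
    have := eq_conj_of_arrow_eq (f := (R (a ≫ b)).hom)
      (g := (R a).hom ≫ eqToHom h ≫ (R b).hom) e ((hl _).symm.trans (hl a))
      ((hr b).trans (hr _).symm)
    rw [this]
    simp
  · exact arrow_eq_of_eq_conj (hl a) (hr a) rfl

end Arrows

/-! ## Gluing diagrams of shape `Ar[m]` -/

section Glue

variable {C : Type u} [Category.{v} C] {m : SimplexCategory}

/-- The object `i ≤ j` of `Ar[m]`. -/
abbrev arMk {i j : Ord m} (h : i ≤ j) : Ar m := Arrow.mk (homOfLE h)

theorem ar_le (x : Ar m) : x.left ≤ x.right := leOfHom x.hom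

theorem ar_left_le {x y : Ar m} (a : x ⟶ y) : x.left ≤ y.left := leOfHom a.left

theorem ar_right_le {x y : Ar m} (a : x ⟶ y) : x.right ≤ y.right := leOfHom a.right

instance (x y : Ar m) : Subsingleton (x ⟶ y) := ⟨ar_hom_ext⟩

/-- The morphism `x ⟶ y` of `Ar[m]` given by inequalities. -/
abbrev arHom {x y : Ar m} (h₁ : x.left ≤ y.left) (h₂ : x.right ≤ y.right) : x ⟶ y :=
  Arrow.homMk (homOfLE h₁) (homOfLE h₂) (Subsingleton.elim _ _)

/-- The upper right corner of the rectangle spanned by `x` and `y`. -/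
abbrev arCorner {x y : Ar m} (a : x ⟶ y) : Ar m := arMk ((ar_left_le a).trans (ar_le y))

/-- The horizontal part of a morphism of `Ar[m]`. -/
abbrev arHoriz {x y : Ar m} (a : x ⟶ y) : x ⟶ arCorner a :=
  arHom (y := arCorner a) le_rfl (leOfHom a.right)

/-- The vertical part of a morphism of `Ar[m]`. -/
abbrev arVert {x y : Ar m} (a : x ⟶ y) : arCorner a ⟶ y :=
  arHom (x := arCorner a) (leOfHom a.left) le_rfl

/-- Every morphism of `Ar[m]` is horizontal followed by vertical. -/
theorem ar_factor {x y : Ar m} (a : x ⟶ y) :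
    a = arHoriz a ≫
      arVert a :=
  Subsingleton.elim _ _

/-- Arrows `(i, j) ⟶ (i', j')` of `C` for all `i ≤ i' ≤ j ≤ j'`. -/
abbrev ArrowGrid (m : SimplexCategory) (S : Type*) : Type _ :=
  ∀ i i' j j' : Ord m, i ≤ i' → i' ≤ j → j ≤ j' → S

/-- A functorial family of arrows `(i, j) ⟶ (i', j')` for `i ≤ i' ≤ j ≤ j'` extends to `Ar[m]`. -/
theorem exists_functor_of_arrowGrid (Q : ArrowGrid m (Arrow C))
    (hid : ∀ i j (h : i ≤ j), ∃ X : C, Q i i j j le_rfl h le_rfl = Arrow.mk (𝟙 X))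
    (hcomp : ∀ i i' i'' j j' j'' (h₁ : i ≤ i') (h₂ : i' ≤ i'') (h₃ : i'' ≤ j) (h₄ : j ≤ j')
      (h₅ : j' ≤ j''), IsComp (Q i i' j j' h₁ (h₂.trans h₃) h₄)
        (Q i' i'' j' j'' h₂ (h₃.trans h₄) h₅)
        (Q i i'' j j'' (h₁.trans h₂) h₃ (h₄.trans h₅))) :
    ∃ F : Ar m ⥤ C, ∀ {x y : Ar m} (a : x ⟶ y) (h : y.left ≤ x.right),
      Arrow.mk (F.map a) = Q x.left y.left x.right y.right (ar_left_le a) h (ar_right_le a) := by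
  -- A general morphism is assigned the composite through the corner `(x.left, y.right)`. Both legs
  -- belong to the family, even if `x.right < y.left`.
  have hR {x y : Ar m} (a : x ⟶ y) : ∃ r : Arrow C,
      IsComp (Q x.left x.left x.right y.right le_rfl (ar_le x) (ar_right_le a))
        (Q x.left y.left y.right y.right (ar_left_le a) (ar_le y) le_rfl) r := by
    obtain ⟨h₁, -⟩ := hcomp x.left x.left x.left x.right y.right y.right le_rfl le_rfl (ar_le x)
      (ar_right_le a) le_rfl
    obtain ⟨h₂, -⟩ := hcomp x.left x.left y.left y.right y.right y.right le_rfl (ar_left_le a)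
      (ar_le y) le_rfl le_rfl
    obtain ⟨X, hX⟩ := hid x.left y.right ((ar_le x).trans (ar_right_le a))
    refine ⟨_, ⟨?_, rfl⟩⟩
    rw [hX] at h₁ h₂
    exact h₁.trans h₂
  choose R hR using @hR
  have hQ {x y : Ar m} (a : x ⟶ y) (h : y.left ≤ x.right) :
      R a = Q x.left y.left x.right y.right (ar_left_le a) h (ar_right_le a) :=
    (hR a).unique (hcomp x.left x.left y.left x.right y.right y.right le_rfl (ar_left_le a) h
      (ar_right_le a) le_rfl)
  obtain ⟨F, hF⟩ := exists_functor_of_arrows R (fun x => by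
      obtain ⟨X, hX⟩ := hid x.left x.right (ar_le x)
      exact ⟨X, (hQ (𝟙 x) (ar_le x)).trans hX⟩)
    -- The exchange takes place in the rectangle with rows `x.left, y.left` and columns `y.right,
    -- z.right`; it lies in `Ar[m]` because `y.left ≤ y.right`.
    (fun {x y z} a b => (hR a).paste (hR b)
      (hcomp x.left y.left y.left y.right y.right z.right (ar_left_le a) le_rfl (ar_le y) le_rfl
        (ar_right_le b))
      (hcomp x.left x.left y.left y.right z.right z.right le_rfl (ar_left_le a) (ar_le y)
        (ar_right_le b) le_rfl)
      (hcomp x.left x.left x.left x.right y.right z.right le_rfl le_rfl (ar_le x)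
        (ar_right_le a) (ar_right_le b))
      (hcomp x.left y.left z.left z.right z.right z.right (ar_left_le a) (ar_left_le b) (ar_le z)
        le_rfl le_rfl) (hR (a ≫ b)))
  exact ⟨F, fun a h => (hF a).trans (hQ a h)⟩

theorem functor_ext_of_arrowGrid {F G : Ar m ⥤ C}
    (h : ∀ {x y : Ar m} (a : x ⟶ y), y.left ≤ x.right →
      Arrow.mk (F.map a) = Arrow.mk (G.map a)) : F = G := by
  refine functor_eq_of_arrow_eq fun {x y} a => ?_
  rw [ar_factor a, F.map_comp, G.map_comp]
  have h₁ := isComp_mk (F.map (arHoriz a))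
    (F.map (arVert a))
  rw [h (arHoriz a) (ar_le x), h (arVert a) (ar_le y)] at h₁
  exact h₁.unique (isComp_mk _ _)

/-- The version of `exists_functor_of_arrowGrid` for families which are only given for `c ≤ j`,
where `c ≤ 1`: the extension takes the given initial object as value where `j < c`. -/
theorem exists_functor_of_partial_arrowGrid {c : ℕ} (hc : c ≤ 1) (Q : ArrowGrid m (Arrow C))
    (hid : ∀ i j (h : i ≤ j), c ≤ j.val → ∃ X : C, Q i i j j le_rfl h le_rfl = Arrow.mk (𝟙 X))
    (hcomp : ∀ i i' i'' j j' j'' (h₁ : i ≤ i') (h₂ : i' ≤ i'') (h₃ : i'' ≤ j) (h₄ : j ≤ j')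
      (h₅ : j' ≤ j''), c ≤ j.val → IsComp (Q i i' j j' h₁ (h₂.trans h₃) h₄)
        (Q i' i'' j' j'' h₂ (h₃.trans h₄) h₅)
        (Q i i'' j j'' (h₁.trans h₂) h₃ (h₄.trans h₅)))
    {Z : C} (hZ : IsInitial Z) :
    ∃ F : Ar m ⥤ C, (∀ {x y : Ar m} (a : x ⟶ y) (h : y.left ≤ x.right), c ≤ x.right.val →
      Arrow.mk (F.map a) = Q x.left y.left x.right y.right (ar_left_le a) h (ar_right_le a)) ∧
      ∀ x : Ar m, x.right.val < c → F.obj x = Z := by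
  classical
  -- Since `c ≤ 1`, a column `j < c` is `0`, and `i ≤ i' ≤ j` forces the rows to be `0` as well.
  -- This is why the row `i` can stand for `i'` in the target of the initial map.
  let Q' : ArrowGrid m (Arrow C) := fun i i' j j' h₁ h₂ h₃ =>
    if c ≤ j.val then Q i i' j j' h₁ h₂ h₃ else
      if c ≤ j'.val then
        Arrow.mk (hZ.to (Q i i j' j' le_rfl (h₁.trans (h₂.trans h₃)) le_rfl).left)
      else Arrow.mk (𝟙 Z)
  obtain ⟨F, hF⟩ := exists_functor_of_arrowGrid Q' (fun i j h => by
      by_cases hj : c ≤ j.val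
      · simpa only [Q', if_pos hj] using hid i j h hj
      · exact ⟨Z, by simp only [Q', if_neg hj]⟩)
    (fun i i' i'' j j' j'' h₁ h₂ h₃ h₄ h₅ => by
      have h₄' : j.val ≤ j'.val := h₄
      have h₅' : j'.val ≤ j''.val := h₅
      by_cases hj : c ≤ j.val
      · simpa only [Q', if_pos hj, if_pos (hj.trans h₄')] using
          hcomp i i' i'' j j' j'' h₁ h₂ h₃ h₄ h₅ hj
      · have e : j.val = 0 := by omega
        have k₃ : i''.val ≤ j.val := h₃
        have k₂ : i'.val ≤ i''.val := h₂
        have k₁ : i.val ≤ i'.val := h₁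
        obtain rfl : i = i' := Fin.ext (by omega)
        obtain rfl : i = i'' := Fin.ext (by omega)
        by_cases hj' : c ≤ j'.val
        · have hj'' : c ≤ j''.val := hj'.trans h₅'
          simp only [Q', if_neg hj, if_pos hj', if_pos hj'']
          obtain ⟨e₁, -⟩ := hcomp i i i j' j' j'' le_rfl le_rfl (h₃.trans h₄) le_rfl h₅ hj'
          obtain ⟨e₂, -⟩ := hcomp i i i j' j'' j'' le_rfl le_rfl (h₃.trans h₄) h₅ le_rfl hj'
          obtain ⟨X, hX⟩ := hid i j' (h₃.trans h₄) hj'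
          rw [hX] at e₁
          have e₀ : (Q i i j' j' le_rfl (h₃.trans h₄) le_rfl).left =
            (Q i i j' j'' le_rfl (h₃.trans h₄) h₅).left := by rw [hX]; exact e₁
          refine ⟨e₀, ?_⟩
          exact arrow_eq_of_eq_conj rfl e₂ (hZ.hom_ext _ _)
        · by_cases hj'' : c ≤ j''.val
          · simp only [Q', if_neg hj, if_neg hj', if_pos hj'']
            exact ⟨rfl, by simp⟩
          · simp only [Q', if_neg hj, if_neg hj', if_neg hj'']
            exact ⟨rfl, by simp⟩)
  refine ⟨F, fun {x y} a h hx => (hF a h).trans (if_pos hx), fun x hx => ?_⟩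
  have := hF (𝟙 x) (ar_le x)
  simp only [Q', if_neg (not_le.2 hx)] at this
  exact congrArg Comma.left this

/-- Compatible components of a transformation glue; only the part where `c ≤ j` needs to be given
if the values elsewhere are initial. -/
theorem exists_natTrans_of_arrowGrid {F G : Ar m ⥤ C} (c : ℕ) (T : Ar m → Arrow C)
    (hT : ∀ {x y : Ar m} (a : x ⟶ y), y.left ≤ x.right → c ≤ x.right.val →
      ∃ (s : F.obj x ⟶ G.obj x) (t : F.obj y ⟶ G.obj y), Arrow.mk s = T x ∧ Arrow.mk t = T y ∧
        F.map a ≫ t = s ≫ G.map a)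
    (hF : ∀ x : Ar m, x.right.val < c → Nonempty (IsInitial (F.obj x))) :
    ∃ τ : F ⟶ G, ∀ x : Ar m, c ≤ x.right.val → Arrow.mk (τ.app x) = T x := by
  have h (x : Ar m) : ∃ s : F.obj x ⟶ G.obj x, c ≤ x.right.val → Arrow.mk s = T x := by
    by_cases hx : c ≤ x.right.val
    · obtain ⟨s, -, hs, -⟩ := hT (𝟙 x) (ar_le x) hx
      exact ⟨s, fun _ => hs⟩
    · obtain ⟨i⟩ := hF x (not_le.1 hx)
      exact ⟨i.to _, fun h => (hx h).elim⟩
  choose s hs using h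
  -- Naturality is needed only for morphisms lying in a rectangle, because the horizontal and
  -- vertical factors of any morphism do.
  have key {x y : Ar m} (a : x ⟶ y) (h : y.left ≤ x.right) :
      F.map a ≫ s y = s x ≫ G.map a := by
    by_cases hx : c ≤ x.right.val
    · obtain ⟨s', t', h₁, h₂, e⟩ := hT a h hx
      have hy : c ≤ y.right.val := hx.trans (ar_right_le a)
      rw [Arrow.mk_injective _ _ ((hs x hx).trans h₁.symm),
        Arrow.mk_injective _ _ ((hs y hy).trans h₂.symm), e]
    · obtain ⟨i⟩ := hF x (not_le.1 hx)
      exact i.hom_ext _ _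
  refine ⟨{ app := s, naturality := fun x y a => ?_ }, fun x hx => hs x hx⟩
  rw [ar_factor a, F.map_comp, G.map_comp, Category.assoc, key (arVert a) (ar_le y), ← Category.assoc,
    key (arHoriz a) (ar_le x), Category.assoc]

end Glue

/-! ## Compatible families on grids -/

section Families

variable {S : Type*} {m : SimplexCategory}

theorem ord_le_val {n : SimplexCategory} {a b : Ord n} (h : a ≤ b) : a.val ≤ b.val := h

theorem grid_hom_ext {y : DeltaSq} {z z' : Grid y} (f g : z ⟶ z') : f = g :=
  Prod.ext (Subsingleton.elim _ _) (Subsingleton.elim _ _)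

/-- The point of `[q + 1 + r]` corresponding to `a ∈ [q]`. -/
abbrev joinL (y : DeltaSq) (a : Ord y.1) : Ord (join.obj y) :=
  (⟨a.val, by omega⟩ : Fin (y.1.len + y.2.len + 1 + 1))

/-- The point of `[q + 1 + r]` corresponding to `b ∈ [r]`. -/
abbrev joinR (y : DeltaSq) (b : Ord y.2) : Ord (join.obj y) :=
  (⟨y.1.len + 1 + b.val, by omega⟩ : Fin (y.1.len + y.2.len + 1 + 1))

theorem joinL_mono {y : DeltaSq} {a a' : Ord y.1} (h : a ≤ a') : joinL y a ≤ joinL y a' := h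

theorem joinR_mono {y : DeltaSq} {b b' : Ord y.2} (h : b ≤ b') : joinR y b ≤ joinR y b' :=
  Fin.mk_le_mk.2 (Nat.add_le_add_left (ord_le_val h) _)

theorem joinL_le_joinR {y : DeltaSq} (a : Ord y.1) (b : Ord y.2) : joinL y a ≤ joinR y b :=
  Fin.mk_le_mk.2 (by omega)

theorem join_map_joinL {x y : DeltaSq} (g : x ⟶ y) (a : Ord x.1) :
    (join.map g).toOrderHom (joinL x a) = joinL y (g.1.toOrderHom a) :=
  Fin.ext (joinHom_left g.1 g.2 _ a rfl)

theorem join_map_joinR {x y : DeltaSq} (g : x ⟶ y) (b : Ord x.2) :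
    (join.map g).toOrderHom (joinR x b) = joinR y (g.2.toOrderHom b) :=
  Fin.ext (joinHom_right g.1 g.2 _ b rfl)

theorem join_hom_ext {y : DeltaSq} {β β' : join.obj y ⟶ m}
    (h₁ : ∀ a, β.toOrderHom (joinL y a) = β'.toOrderHom (joinL y a))
    (h₂ : ∀ b, β.toOrderHom (joinR y b) = β'.toOrderHom (joinR y b)) : β = β' := by
  refine hom_ext_val fun i => ?_
  obtain ⟨a, ha⟩ | ⟨b, hb⟩ := join_cases y.1.len y.2.len i
  · obtain rfl : i = joinL y a := Fin.ext ha
    exact congrArg Fin.val (h₁ a)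
  · obtain rfl : i = joinR y b := Fin.ext hb
    exact congrArg Fin.val (h₂ b)

/-- The image in `Ar[m]` of a point of a grid. -/
abbrev gridPoint {y : DeltaSq} (β : join.obj y ⟶ m) : Grid y ⥤ Ar m := gridToAr y ⋙ arMap β

/-- A family of elements indexed by the morphisms of all grids in `Ar[m]`. -/
structure ArrFam (S : Type*) (m : SimplexCategory) where
  fam : ∀ (y : DeltaSq) (_ : join.obj y ⟶ m) {z z' : Grid y} (_ : z ⟶ z'), S
  compat : ∀ {y' y : DeltaSq} (g : y' ⟶ y) (β : join.obj y ⟶ m) {z z' : Grid y'} (f : z ⟶ z'),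
    fam y β ((gridMap g).map f) = fam y' (join.map g ≫ β) f

/-- The map `[1] ⟶ [n]` given by two vertices. -/
def pairHom {n : SimplexCategory} (a b : Ord n) (h : a ≤ b) : (⦋1⦌ : SimplexCategory) ⟶ n :=
  SimplexCategory.mkHom (n := 1) (m := n.len)
    { toFun := fun i => if i.val = 0 then a else b
      monotone' := fun i i' hi => by
        have : i.val ≤ i'.val := hi
        dsimp only
        split_ifs
        · exact le_rfl
        · exact h
        · omega
        · exact le_rfl }

/-- The map `[q + 1 + r] ⟶ [m]` given by maps on `[q]` and `[r]`. -/
def copair {y : DeltaSq} (s : Ord y.1 →o Ord m) (t : Ord y.2 →o Ord m)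
    (h : ∀ a b, s a ≤ t b) : join.obj y ⟶ m :=
  SimplexCategory.mkHom (n := y.1.len + y.2.len + 1) (m := m.len)
    { toFun := fun i => if hi : i.val ≤ y.1.len then s ⟨i.val, by omega⟩ else
        t ⟨i.val - (y.1.len + 1), by omega⟩
      monotone' := fun i i' hi => by
        have hi' : i.val ≤ i'.val := hi
        dsimp only
        split_ifs
        · exact s.monotone hi
        · exact h _ _
        · omega
        · exact t.monotone (Fin.mk_le_mk.2 (by omega)) }

theorem copair_joinL {y : DeltaSq} (s : Ord y.1 →o Ord m) (t : Ord y.2 →o Ord m)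
    (h : ∀ a b, s a ≤ t b) (a : Ord y.1) :
    (copair s t h).toOrderHom (joinL y a) = s a :=
  dif_pos (show a.val ≤ y.1.len by omega)

theorem copair_joinR {y : DeltaSq} (s : Ord y.1 →o Ord m) (t : Ord y.2 →o Ord m)
    (h : ∀ a b, s a ≤ t b) (b : Ord y.2) :
    (copair s t h).toOrderHom (joinR y b) = t b :=
  (dif_neg (show ¬ y.1.len + 1 + b.val ≤ y.1.len by omega)).trans
    (congrArg t (Fin.ext (Nat.add_sub_cancel_left _ _)))

/-- The map `[1 + 1 + 1] ⟶ [m]` given by `i ≤ i' ≤ j ≤ j'`. -/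
def quad (i i' j j' : Ord m) (h₁ : i ≤ i') (h₂ : i' ≤ j) (h₃ : j ≤ j') :
    join.obj (⦋1⦌, ⦋1⦌) ⟶ m :=
  copair (pairHom i i' h₁).toOrderHom (pairHom j j' h₃).toOrderHom (fun a b => by
    have ha : (pairHom i i' h₁).toOrderHom a ≤ i' := by
      change (if a.val = 0 then i else i') ≤ i'
      split_ifs
      exacts [h₁, le_rfl]
    have hb : j ≤ (pairHom j j' h₃).toOrderHom b := by
      change j ≤ (if b.val = 0 then j else j')
      split_ifs
      exacts [le_rfl, h₃]
    exact ha.trans (h₂.trans hb))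

/-- The diagonal of the square. -/
abbrev diagHom : ((0, 0) : Grid (⦋1⦌, ⦋1⦌)) ⟶ (1, 1) :=
  (homOfLE (Fin.zero_le _), homOfLE (Fin.zero_le _))

namespace ArrFam

variable (W : ArrFam S m)

theorem congr_arrow {y : DeltaSq} (β : join.obj y ⟶ m) {z z' w w' : Grid y} (f : z ⟶ z')
    (g : w ⟶ w') (h : z = w) (h' : z' = w') : W.fam y β f = W.fam y β g := by
  subst h h'
  rw [grid_hom_ext f g]

/-- The value of a family at the diagonal of the square `i ≤ i' ≤ j ≤ j'`. -/
def quadVal : ArrowGrid m S := fun i i' j j' h₁ h₂ h₃ =>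
  W.fam (⦋1⦌, ⦋1⦌) (quad i i' j j' h₁ h₂ h₃) diagHom

/-- The values of a family at squares determine it. -/
theorem fam_eq {y : DeltaSq} (β : join.obj y ⟶ m) {z z' : Grid y} (f : z ⟶ z') :
    W.fam y β f = W.quadVal (β.toOrderHom (joinL y z.1)) (β.toOrderHom (joinL y z'.1))
      (β.toOrderHom (joinR y z.2)) (β.toOrderHom (joinR y z'.2))
      (β.toOrderHom.monotone (joinL_mono (leOfHom f.1)))
      (β.toOrderHom.monotone (joinL_le_joinR _ _))
      (β.toOrderHom.monotone (joinR_mono (leOfHom f.2))) := by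
  -- Any morphism `z ⟶ z'` of a grid is the image of the diagonal of `[1] × [1]` under the map
  -- picking out `z` and `z'`, so compatibility along `g` reduces to squares.
  let g : ((⦋1⦌, ⦋1⦌) : DeltaSq) ⟶ y :=
    (pairHom z.1 z'.1 (leOfHom f.1), pairHom z.2 z'.2 (leOfHom f.2))
  refine Eq.trans (W.congr_arrow β f ((gridMap g).map diagHom) rfl rfl) ((W.compat g β _).trans ?_)
  refine congrArg (fun t => W.fam (⦋1⦌, ⦋1⦌) t diagHom) (join_hom_ext (fun a => ?_) (fun b => ?_))
  · refine Eq.trans ?_ (copair_joinL _ _ _ a).symm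
    refine (congrArg β.toOrderHom (join_map_joinL g a)).trans ?_
    change β.toOrderHom (joinL y (if a.val = 0 then z.1 else z'.1)) = if a.val = 0 then _ else _
    split_ifs <;> rfl
  · refine Eq.trans ?_ (copair_joinR _ _ _ b).symm
    refine (congrArg β.toOrderHom (join_map_joinR g b)).trans ?_
    change β.toOrderHom (joinR y (if b.val = 0 then z.2 else z'.2)) = if b.val = 0 then _ else _
    split_ifs <;> rfl

end ArrFam

end Families

/-! ### From families on grids to diagrams and isomorphisms on `Ar[m]` -/

section Families

variable {C : Type u} [Category.{v} C] {m : SimplexCategory}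

theorem quad_joinL {i i' j j' : Ord m} (h₁ : i ≤ i') (h₂ : i' ≤ j) (h₃ : j ≤ j') (a : Fin 2) :
    (quad i i' j j' h₁ h₂ h₃).toOrderHom (joinL _ a) = if a.val = 0 then i else i' :=
  copair_joinL (y := (⦋1⦌, ⦋1⦌)) _ _ _ a

theorem quad_joinR {i i' j j' : Ord m} (h₁ : i ≤ i') (h₂ : i' ≤ j) (h₃ : j ≤ j') (b : Fin 2) :
    (quad i i' j j' h₁ h₂ h₃).toOrderHom (joinR _ b) = if b.val = 0 then j else j' :=
  copair_joinR (y := (⦋1⦌, ⦋1⦌)) _ _ _ b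

/-- A rectangle in `Ar[m]` lies in a grid. -/
theorem exists_gridPoint {i i' j j' : Ord m} (h₁ : i ≤ i') (h₂ : i' ≤ j) (h₃ : j ≤ j') :
    ∃ β : join.obj (⦋1⦌, ⦋1⦌) ⟶ m,
      ∀ (x : Ar m) (a b : Fin 2), x.left = (if a.val = 0 then i else i') →
        x.right = (if b.val = 0 then j else j') → (gridPoint β).obj (a, b) = x :=
  ⟨quad i i' j j' h₁ h₂ h₃, fun _ a b hl hr =>
    ar_ext ((quad_joinL h₁ h₂ h₃ a).trans hl.symm) ((quad_joinR h₁ h₂ h₃ b).trans hr.symm)⟩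

theorem exists_gridPoint_of_hom {x y : Ar m} (a : x ⟶ y) (h : y.left ≤ x.right) :
    ∃ β : join.obj (⦋1⦌, ⦋1⦌) ⟶ m, (gridPoint β).obj (0, 0) = x ∧ (gridPoint β).obj (1, 1) = y := by
  obtain ⟨β, hβ⟩ := exists_gridPoint (ar_left_le a) h (ar_right_le a)
  exact ⟨β, hβ x 0 0 rfl rfl, hβ y 1 1 rfl rfl⟩

/-- Diagrams of shape `Ar[m]` are determined by their restrictions to grids. -/
theorem functor_ext_of_gridPoint {F G : Ar m ⥤ C}
    (h : ∀ β : join.obj (⦋1⦌, ⦋1⦌) ⟶ m, gridPoint β ⋙ F = gridPoint β ⋙ G) : F = G := by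
  refine functor_ext_of_arrowGrid fun {x y} a hxy => ?_
  obtain ⟨β, rfl, rfl⟩ := exists_gridPoint_of_hom a hxy
  rw [Subsingleton.elim a ((gridPoint β).map diagHom)]
  exact arrow_map_eq (h β) diagHom

namespace ArrFam

/-- The family of arrows is compatible with identities and compositions. -/
structure Functorial (W : ArrFam (Arrow C) m) : Prop where
  id : ∀ (y : DeltaSq) (β : join.obj y ⟶ m) (z : Grid y), ∃ X : C, W.fam y β (𝟙 z) = Arrow.mk (𝟙 X)
  comp : ∀ (y : DeltaSq) (β : join.obj y ⟶ m) {z z' z'' : Grid y} (f : z ⟶ z') (g : z' ⟶ z''),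
    IsComp (W.fam y β f) (W.fam y β g) (W.fam y β (f ≫ g))

variable {W : ArrFam (Arrow C) m}

/-- `diagHom` itself is not an identity. But the value depends only on the image in `Ar[m]`, and the
same image is that of an identity of the grid `[0] × [0]`. -/
theorem Functorial.quadVal_id (hW : W.Functorial) (i j : Ord m) (h : i ≤ j) :
    ∃ X : C, W.quadVal i i j j le_rfl h le_rfl = Arrow.mk (𝟙 X) := by
  let β : join.obj zz ⟶ m := copair (OrderHom.const _ i) (OrderHom.const _ j) (fun _ _ => h)
  obtain ⟨X, hX⟩ := hW.id zz β (0, 0)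
  exact ⟨X, (W.fam_eq β (𝟙 (0, 0))).symm.trans hX⟩

/-- The map `[2] ⟶ [m]` given by three vertices. -/
def triple (i i' i'' : Ord m) (h₁ : i ≤ i') (h₂ : i' ≤ i'') : Ord (⦋2⦌ : SimplexCategory) →o Ord m where
  toFun k := if k.val = 0 then i else if k.val = 1 then i' else i''
  monotone' k l hkl := by
    have : k.val ≤ l.val := hkl
    dsimp only
    split_ifs
    all_goals first | omega | (exact le_rfl) | (exact h₁) | (exact h₂) | (exact h₁.trans h₂)

theorem triple_le (i i' i'' : Ord m) (h₁ : i ≤ i') (h₂ : i' ≤ i'') (k) :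
    triple i i' i'' h₁ h₂ k ≤ i'' := by
  change (if k.val = 0 then i else if k.val = 1 then i' else i'') ≤ i''
  split_ifs
  exacts [h₁.trans h₂, h₂, le_rfl]

theorem le_triple (i i' i'' : Ord m) (h₁ : i ≤ i') (h₂ : i' ≤ i'') (k) :
    i ≤ triple i i' i'' h₁ h₂ k := by
  change i ≤ (if k.val = 0 then i else if k.val = 1 then i' else i'')
  split_ifs
  exacts [le_rfl, h₁, h₁.trans h₂]

/-- The two triples span a `[2] × [2]` grid, legitimate because `i'' ≤ j`, in which both diagonals
and their composite are morphisms. -/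
theorem Functorial.quadVal_comp (hW : W.Functorial) (i i' i'' j j' j'' : Ord m) (h₁ : i ≤ i')
    (h₂ : i' ≤ i'') (h₃ : i'' ≤ j) (h₄ : j ≤ j') (h₅ : j' ≤ j'') :
    IsComp (W.quadVal i i' j j' h₁ (h₂.trans h₃) h₄) (W.quadVal i' i'' j' j'' h₂ (h₃.trans h₄) h₅)
      (W.quadVal i i'' j j'' (h₁.trans h₂) h₃ (h₄.trans h₅)) := by
  let y : DeltaSq := (⦋2⦌, ⦋2⦌)
  let β : join.obj y ⟶ m := copair (triple i i' i'' h₁ h₂) (triple j j' j'' h₄ h₅)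
    (fun a b => (triple_le _ _ _ _ _ a).trans (h₃.trans (le_triple _ _ _ _ _ b)))
  let f : ((0, 0) : Grid y) ⟶ ((1, 1) : Grid y) :=
    (homOfLE (by decide : (0 : Fin 3) ≤ 1), homOfLE (by decide : (0 : Fin 3) ≤ 1))
  let g : ((1, 1) : Grid y) ⟶ ((2, 2) : Grid y) :=
    (homOfLE (by decide : (1 : Fin 3) ≤ 2), homOfLE (by decide : (1 : Fin 3) ≤ 2))
  have h := hW.comp y β f g
  rw [W.fam_eq β f, W.fam_eq β g, W.fam_eq β (f ≫ g)] at h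
  exact h

/-- A functorial family of arrows comes from a diagram of shape `Ar[m]`. -/
theorem Functorial.exists_functor (hW : W.Functorial) {c : ℕ} (hc : c ≤ 1) {Z : C}
    (hZ : IsInitial Z) :
    ∃ F : Ar m ⥤ C, (∀ {y : DeltaSq} (β : join.obj y ⟶ m) {z z' : Grid y} (f : z ⟶ z'),
      c ≤ (β.toOrderHom (joinR y z.2)).val →
        Arrow.mk (F.map ((gridPoint β).map f)) = W.fam y β f) ∧
      ∀ x : Ar m, x.right.val < c → F.obj x = Z := by
  obtain ⟨F, hF, hF'⟩ := exists_functor_of_partial_arrowGrid hc W.quadVal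
    (fun i j h _ => hW.quadVal_id i j h)
    (fun i i' i'' j j' j'' h₁ h₂ h₃ h₄ h₅ _ => hW.quadVal_comp i i' i'' j j' j'' h₁ h₂ h₃ h₄ h₅) hZ
  exact ⟨F, fun {y} β {z z'} f h => (hF _ (β.toOrderHom.monotone (joinL_le_joinR _ _)) h).trans
    (W.fam_eq β f).symm, hF'⟩

/-- A compatible family of isomorphisms between the restrictions to grids comes from an
isomorphism of diagrams of shape `Ar[m]`. -/
theorem exists_iso {F G : Ar m ⥤ C} (W : ArrFam (Arrow C) m) (c : ℕ)
    (hW : ∀ β : join.obj (⦋1⦌, ⦋1⦌) ⟶ m, c ≤ (β.toOrderHom (joinR _ 0)).val →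
      ∃ θ : gridPoint β ⋙ F ≅ gridPoint β ⋙ G, ∀ z,
        Arrow.mk (θ.hom.app z) = W.fam _ β (𝟙 z))
    (hF : ∀ x : Ar m, x.right.val < c → Nonempty (IsInitial (F.obj x)))
    (hG : ∀ x : Ar m, x.right.val < c → Nonempty (IsInitial (G.obj x))) :
    ∃ e : F ≅ G, ∀ {y : DeltaSq} (β : join.obj y ⟶ m) (z : Grid y),
      c ≤ (β.toOrderHom (joinR y z.2)).val →
        Arrow.mk (e.hom.app ((gridPoint β).obj z)) = W.fam y β (𝟙 z) := by
  let T : Ar m → Arrow C := fun x =>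
    W.quadVal x.left x.left x.right x.right le_rfl (ar_le x) le_rfl
  have hT {y : DeltaSq} (β : join.obj y ⟶ m) (z : Grid y) :
      T ((gridPoint β).obj z) = W.fam y β (𝟙 z) := (W.fam_eq β (𝟙 z)).symm
  obtain ⟨τ, hτ⟩ := exists_natTrans_of_arrowGrid (F := F) (G := G) c T (fun {x y} a h hx => by
    obtain ⟨β, rfl, rfl⟩ := exists_gridPoint_of_hom a h
    obtain ⟨θ, hθ⟩ := hW β hx
    refine ⟨θ.hom.app (0, 0), θ.hom.app (1, 1), (hθ _).trans (hT β _).symm,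
      (hθ _).trans (hT β _).symm, ?_⟩
    rw [Subsingleton.elim a ((gridPoint β).map diagHom)]
    exact θ.hom.naturality diagHom) hF
  have (x : Ar m) : IsIso (τ.app x) := by
    by_cases hx : c ≤ x.right.val
    · obtain ⟨β, hβ, -⟩ := exists_gridPoint_of_hom (𝟙 x) (ar_le x)
      subst hβ
      obtain ⟨θ, hθ⟩ := hW β hx
      have e : τ.app _ = θ.hom.app (0, 0) :=
        Arrow.mk_injective _ _ ((hτ _ hx).trans ((hT β _).trans (hθ _).symm))
      rw [e]
      infer_instance
    -- Below the cutoff both values are initial, so the only map between them is invertible.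
    · obtain ⟨i⟩ := hF x (not_le.1 hx)
      obtain ⟨k⟩ := hG x (not_le.1 hx)
      rw [i.hom_ext (τ.app x) (i.uniqueUpToIso k).hom]
      infer_instance
  have : IsIso τ := NatIso.isIso_of_isIso_app τ
  exact ⟨asIso τ, fun β z hz => (hτ _ hz).trans (hT β z)⟩

end ArrFam

end Families

/-! ### Components of morphisms in groupoids of diagrams -/

section Components

variable {A : Type u} [Category.{v} A]

/-- Conjugation by equalities of objects does not change the components of a morphism of
diagrams. -/
theorem IsoFull.arrow_app_eq {D : Type} [SmallCategory D] {P : ObjectProperty (D ⥤ A)}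
    {X Y X' Y' : IsoFull P} {a : X ⟶ Y} {b : X' ⟶ Y'} (h₁ : X = X') (h₂ : Y' = Y)
    (h : a = eqToHom h₁ ≫ b ≫ eqToHom h₂) (z : D) :
    Arrow.mk (Iso.hom (show X.obj ≅ Y.obj from a) |>.app z) =
      Arrow.mk (Iso.hom (show X'.obj ≅ Y'.obj from b) |>.app z) := by
  subst h₁ h₂
  rw [eqToHom_refl, eqToHom_refl, Category.id_comp, Category.comp_id] at h
  subst h
  rfl

theorem IsoFull.hom_ext {D : Type} [SmallCategory D] {P : ObjectProperty (D ⥤ A)}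
    {X Y : IsoFull P} {a b : X ⟶ Y}
    (h : ∀ z, (Iso.hom (show X.obj ≅ Y.obj from a)).app z =
      (Iso.hom (show X.obj ≅ Y.obj from b)).app z) : a = b :=
  Iso.ext (NatTrans.ext (funext h))

theorem IsoFull.obj_ext {D : Type} [SmallCategory D] {P : ObjectProperty (D ⥤ A)}
    {X Y : IsoFull P} (h : X.obj = Y.obj) : X = Y := by
  cases X; cases Y; congr

theorem exists_iso_of_eq {D : Type} [SmallCategory D] {X Y X' Y' : D ⥤ A} (h₁ : X' = X)
    (h₂ : Y' = Y) (ψ : X' ≅ Y') :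
    ∃ θ : X ≅ Y, ∀ z, Arrow.mk (θ.hom.app z) = Arrow.mk (ψ.hom.app z) := by
  subst h₁ h₂
  exact ⟨ψ, fun _ => rfl⟩

end Components

/-! ## Admissible diagrams of shape `Ar[m]` -/

section Exact

variable {A : Type u} [Category.{v} A] [Preadditive A] [HasFiniteBiproducts A] [ExactCategory A]
variable {m : SimplexCategory}

/-- The axioms give only the identity of a zero object as an admissible epimorphism. Its pullback
along `X ⟶ Z` is an isomorphism `q` onto `X` with zero kernel, and the sequence is transported along
`q`. -/
theorem seq_zero_id {Z X : A} (hZ : IsZero Z) :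
    ExactCategory.seq (ShortComplex.mk (0 : Z ⟶ X) (𝟙 X) zero_comp) := by
  obtain ⟨Y, g, q, pb, K, i, w, h⟩ := ExactCategory.pullback (0 : X ⟶ Z) (𝟙 Z)
    (ExactCategory.admEpi_id_zero Z hZ)
  have : IsIso q := pb.isIso_snd_of_isIso
  obtain ⟨l⟩ := ExactCategory.isKernel _ h
  have : Mono i := Fork.IsLimit.mono l
  have hK : IsZero K := (IsZero.iff_id_eq_zero K).2 (by
    rw [← cancel_mono i, ← cancel_mono q, Category.assoc, w, comp_zero, zero_comp, zero_comp])
  exact ExactCategory.of_iso (S := ShortComplex.mk i q w) (ShortComplex.isoMk (hK.iso hZ) (asIso q)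
    (Iso.refl X) (hK.eq_of_src _ _) rfl) h

theorem M_of_isZero {Z X : A} (hZ : IsZero Z) (i : Z ⟶ X) : M A i := by
  rw [hZ.eq_of_src i 0]
  exact ⟨X, 𝟙 X, _, seq_zero_id hZ⟩

theorem E_id (X : A) : E A (𝟙 X) := ⟨_, 0, _, seq_zero_id (isZero_zero A)⟩

/-- A diagram of shape `Ar[m]` is admissible if its restrictions to the squares in the part
where `c ≤ j` are, and if its other values are zero; here `c ≤ 1`. -/
theorem isAdmissible_of_gridPoint {F : Ar m ⥤ A} {c : ℕ} (hc : c ≤ 1)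
    (h : ∀ β : join.obj (⦋1⦌, ⦋1⦌) ⟶ m, c ≤ (β.toOrderHom (joinR _ 0)).val →
      gridProp A _ (gridPoint β ⋙ F))
    (hz : ∀ x : Ar m, x.right.val < c → IsZero (F.obj x)) :
    IsAdmissible (fun x => x.left) (fun x => x.right) F := by
  -- Below the cutoff only `(0, 0)` can occur. Hence vertical morphisms there are identities, and
  -- squares starting there have identities as vertical sides.
  have collapse {x y : Ar m} (hx : x.right.val < c) (hr : x.right = y.right) : x = y := by
    have h₁ := ord_le_val (ar_le x)
    have h₂ := ord_le_val (ar_le y)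
    rw [← hr] at h₂
    exact ar_ext (Fin.ext (by omega)) hr
  refine ⟨fun {x y} a hxy => ?_, fun {x y} a hxy => ?_, fun {x y z w} a b d e _ h₁ h₂ h₃ h₄ => ?_⟩
  · by_cases hx : c ≤ x.right.val
    · obtain ⟨β, hβ⟩ := exists_gridPoint (le_refl x.left) (ar_le x) (ar_right_le a)
      obtain rfl := hβ x 0 0 rfl rfl
      obtain rfl := hβ y 0 1 hxy.symm rfl
      let f : ((0, 0) : Grid (⦋1⦌, ⦋1⦌)) ⟶ ((0, 1) : Grid (⦋1⦌, ⦋1⦌)) :=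
        (𝟙 _, homOfLE (Fin.zero_le _))
      rw [Subsingleton.elim a ((gridPoint β).map f)]
      exact (h β hx).horizontal f rfl
    · exact M_of_isZero (hz x (not_le.1 hx)) _
  · by_cases hx : c ≤ x.right.val
    -- Equal columns give `y.left ≤ y.right = x.right`, the inequality that puts a vertical morphism
    -- in a rectangle.
    · obtain ⟨β, hβ⟩ := exists_gridPoint (ar_left_le a) ((ar_le y).trans hxy.ge) (le_refl x.right)
      obtain rfl := hβ x 0 0 rfl rfl
      obtain rfl := hβ y 1 0 rfl hxy.symm
      let f : ((0, 0) : Grid (⦋1⦌, ⦋1⦌)) ⟶ ((1, 0) : Grid (⦋1⦌, ⦋1⦌)) :=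
        (homOfLE (Fin.zero_le _), 𝟙 _)
      rw [Subsingleton.elim a ((gridPoint β).map f)]
      exact (h β hx).vertical f rfl
    · obtain rfl := collapse (not_le.1 hx) hxy
      rw [Subsingleton.elim a (𝟙 x), F.map_id]
      exact E_id _
  · by_cases hx : c ≤ x.right.val
    · obtain ⟨β, hβ⟩ := exists_gridPoint (ar_left_le b) ((ar_le z).trans h₃.ge) (ar_right_le a)
      obtain rfl := hβ x 0 0 rfl rfl
      obtain rfl := hβ y 0 1 h₁.symm rfl
      obtain rfl := hβ z 1 0 rfl h₃.symm
      obtain rfl := hβ w 1 1 h₂.symm h₄.symm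
      let f₁ : ((0, 0) : Grid (⦋1⦌, ⦋1⦌)) ⟶ ((0, 1) : Grid (⦋1⦌, ⦋1⦌)) :=
        (𝟙 _, homOfLE (Fin.zero_le _))
      let f₂ : ((0, 0) : Grid (⦋1⦌, ⦋1⦌)) ⟶ ((1, 0) : Grid (⦋1⦌, ⦋1⦌)) :=
        (homOfLE (Fin.zero_le _), 𝟙 _)
      let f₃ : ((0, 1) : Grid (⦋1⦌, ⦋1⦌)) ⟶ ((1, 1) : Grid (⦋1⦌, ⦋1⦌)) :=
        (homOfLE (Fin.zero_le _), 𝟙 _)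
      let f₄ : ((1, 0) : Grid (⦋1⦌, ⦋1⦌)) ⟶ ((1, 1) : Grid (⦋1⦌, ⦋1⦌)) :=
        (𝟙 _, homOfLE (Fin.zero_le _))
      rw [Subsingleton.elim a ((gridPoint β).map f₁), Subsingleton.elim b ((gridPoint β).map f₂),
        Subsingleton.elim d ((gridPoint β).map f₃), Subsingleton.elim e ((gridPoint β).map f₄)]
      exact (h β hx).square f₁ f₂ f₃ f₄ (grid_hom_ext _ _) rfl rfl rfl rfl
    · obtain rfl := collapse (not_le.1 hx) h₃
      obtain rfl : y = w := ar_ext (h₁.symm.trans h₂) h₄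
      rw [Subsingleton.elim b (𝟙 x), Subsingleton.elim d (𝟙 y), Subsingleton.elim e a, F.map_id,
        F.map_id]
      have sq : CommSq (F.map a) (𝟙 (F.obj x)) (𝟙 (F.obj y)) (F.map a) := ⟨by simp⟩
      exact ⟨IsPullback.of_vert_isIso sq, IsPushout.of_vert_isIso sq⟩

end Exact

/-! ## The comparison map is an isomorphism -/

section Comparison

/-- The object of the indexing category of `(S Y)_m` given by a map `[q + 1 + r] ⟶ [m]`. -/
abbrev idx {m : SimplexCategory} {y : DeltaSq} (β : join.obj y ⟶ m) :
    StructuredArrow (op m) p.op :=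
  StructuredArrow.mk (Y := op (WithTerminal.of y)) (show op m ⟶ p.op.obj _ from β.op)

/-- The object of the indexing category of `(S Y)_m` given by a vertex of `[m]`. -/
abbrev idxStar {m : SimplexCategory} (i : (⦋0⦌ : SimplexCategory) ⟶ m) :
    StructuredArrow (op m) p.op :=
  StructuredArrow.mk (Y := op WithTerminal.star) (show op m ⟶ p.op.obj _ from i.op)

/-- The morphism of the indexing category given by a morphism of `Δ × Δ`. -/
abbrev idxHom {m : SimplexCategory} {y' y : DeltaSq} (g : y' ⟶ y) (β : join.obj y ⟶ m) :
    idx β ⟶ idx (join.map g ≫ β) :=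
  StructuredArrow.homMk (WithTerminal.incl.map g).op rfl

/-- The restriction of the index `(0, 0)` along the augmentation. -/
abbrev idxAug {m : SimplexCategory} (i : (⦋0⦌ : SimplexCategory) ⟶ m) :
    idxStar i ⟶ idx (y := zz) (p.map (WithTerminal.homFrom zz) ≫ i) :=
  StructuredArrow.homMk (WithTerminal.homFrom zz).op rfl

theorem exists_idx_eq {m : SimplexCategory} (k : StructuredArrow (op m) p.op) :
    (∃ (y : DeltaSq) (β : join.obj y ⟶ m), k = idx β) ∨
      ∃ i : (⦋0⦌ : SimplexCategory) ⟶ m, k = idxStar i := by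
  obtain ⟨⟨⟨⟩⟩, ⟨x⟩, f⟩ := k
  match x, f with
  | .of y, f => exact Or.inl ⟨y, f.unop, rfl⟩
  | .star, f => exact Or.inr ⟨f.unop, rfl⟩

variable {m : SimplexCategory}

/-- Objects of `(S Y)_m` are determined by the components in bidegrees, if the augmentation is
injective on objects. -/
theorem genLimit_obj_ext {Y : Preaug Grpd.{v, u}}
    (hY : ∀ a b : Y.augObj, Y.aug.obj a = Y.aug.obj b → a = b)
    {x x' : GrpdLimit (genDiagram Y (op m))}
    (h : ∀ {y : DeltaSq} (β : join.obj y ⟶ m), x.obj (idx β) = x'.obj (idx β)) : x = x' := by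
  refine GrpdLimit.obj_ext fun k => ?_
  obtain ⟨y, β, rfl⟩ | ⟨i, rfl⟩ := exists_idx_eq k
  · exact h β
  -- The component at a vertex is recovered from its image under the augmentation, which by
  -- compatibility is the component at a `(0, 0)`-grid.
  · exact hY _ _ ((x.compat (idxAug i)).trans ((h _).trans (x'.compat (idxAug i)).symm))

theorem genLimit_hom_ext {Y : Preaug Grpd.{v, u}}
    (hY : ∀ (a b : Y.augObj) (s t : a ⟶ b), Y.aug.map s = Y.aug.map t → s = t)
    {x x' : GrpdLimit (genDiagram Y (op m))} {s t : x ⟶ x'}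
    (h : ∀ {y : DeltaSq} (β : join.obj y ⟶ m),
      GrpdLimit.Hom.app s (idx β) = GrpdLimit.Hom.app t (idx β)) : s = t := by
  refine GrpdLimit.hom_ext fun k => ?_
  obtain ⟨y, β, rfl⟩ | ⟨i, rfl⟩ := exists_idx_eq k
  · exact h β
  · refine hY _ _ _ _ ((GrpdLimit.Hom.compat s (idxAug i)).trans
      (Eq.trans ?_ (GrpdLimit.Hom.compat t (idxAug i)).symm))
    rw [h]

variable {A : Type u} [Category.{v} A] [Preadditive A] [HasFiniteBiproducts A] [ExactCategory A]

/-- Zero objects are encoded as diagrams of shape `[0] × [0]`, so the augmentation changes only the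
property attached to a diagram. -/
theorem exactNerve_aug_injective (a b : (exactNerve A).augObj)
    (h : (exactNerve A).aug.obj a = (exactNerve A).aug.obj b) : a = b := by
  rw [show (exactNerve A).aug = _ from Preaug.mk_aug _ _ _] at h
  exact IsoFull.obj_ext (congrArg (fun X : IsoFull (gridProp A zz) => X.obj) h)

theorem exactNerve_aug_faithful (a b : (exactNerve A).augObj) (s t : a ⟶ b)
    (h : (exactNerve A).aug.map s = (exactNerve A).aug.map t) : s = t := by
  have h' := h
  rw [show (exactNerve A).aug = _ from Preaug.mk_aug _ _ _] at h'
  exact h'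

theorem isZero_exactNerve_aug (a : (exactNerve A).augObj) (z : Grid zz) :
    IsZero ((show IsoFull (gridProp A zz) from (exactNerve A).aug.obj a).obj.obj z) := by
  rw [show (exactNerve A).aug = _ from Preaug.mk_aug _ _ _]
  exact (show IsoFull (zeroProp A) from a).property z

/-- The grids of an object of `S_m(N^e A)`. -/
def nerveGrid (x : GrpdLimit (genDiagram (exactNerve A) (op m))) {y : DeltaSq}
    (β : join.obj y ⟶ m) : IsoFull (gridProp A y) :=
  x.obj (idx β)

theorem nerveGrid_compat (x : GrpdLimit (genDiagram (exactNerve A) (op m))) {y' y : DeltaSq}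
    (g : y' ⟶ y) (β : join.obj y ⟶ m) :
    gridMap g ⋙ (nerveGrid x β).obj = (nerveGrid x (join.map g ≫ β)).obj :=
  congrArg (fun X : IsoFull (gridProp A y') => X.obj) (x.compat (idxHom g β))

/-- The arrows in the grids of an object of `S_m(N^e A)`. -/
def nerveArrows (x : GrpdLimit (genDiagram (exactNerve A) (op m))) : ArrFam (Arrow A) m where
  fam _ β _ _ f := Arrow.mk ((nerveGrid x β).obj.map f)
  compat g β _ _ f := arrow_map_eq (nerveGrid_compat x g β) f

theorem nerveArrows_functorial (x : GrpdLimit (genDiagram (exactNerve A) (op m))) :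
    (nerveArrows x).Functorial where
  id _ β z := ⟨_, congrArg Arrow.mk ((nerveGrid x β).obj.map_id z)⟩
  comp y β _ _ _ f g := by
    change IsComp _ _ (Arrow.mk ((nerveGrid x β).obj.map (f ≫ g)))
    rw [Functor.map_comp]
    exact isComp_mk _ _

/-- Compatibility along `idxAug i` identifies this grid with the augmentation of the component at
the vertex `i`. This is the source of the zero objects on the diagonal. -/
theorem isZero_nerveGrid (x : GrpdLimit (genDiagram (exactNerve A) (op m)))
    (i : (⦋0⦌ : SimplexCategory) ⟶ m) (z : Grid zz) :
    IsZero ((nerveGrid x (y := zz) (p.map (WithTerminal.homFrom zz) ≫ i)).obj.obj z) := by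
  have h : (exactNerve A).aug.obj (x.obj (idxStar i)) =
      nerveGrid x (y := zz) (p.map (WithTerminal.homFrom zz) ≫ i) := x.compat (idxAug i)
  rw [← h]
  exact isZero_exactNerve_aug _ z

/-- The vertex `i` of `[m]`. -/
def vertex (i : Ord m) : (⦋0⦌ : SimplexCategory) ⟶ m :=
  SimplexCategory.mkHom (n := 0) (m := m.len) (OrderHom.const _ i)

theorem gridPoint_vertex {x : Ar m} (h : x.left = x.right) :
    (gridPoint (y := zz) (p.map (WithTerminal.homFrom zz) ≫ vertex x.left)).obj (0, 0) = x :=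
  ar_ext rfl h

/-- The isomorphisms of grids which are the components of a morphism of `S_m(N^e A)`. -/
def nerveGridIso {x x' : GrpdLimit (genDiagram (exactNerve A) (op m))} (φ : x ⟶ x')
    {y : DeltaSq} (β : join.obj y ⟶ m) : (nerveGrid x β).obj ≅ (nerveGrid x' β).obj :=
  GrpdLimit.Hom.app φ (idx β)

/-- The components of a morphism of `S_m(N^e A)`. -/
def nerveComponents {x x' : GrpdLimit (genDiagram (exactNerve A) (op m))} (φ : x ⟶ x') :
    ArrFam (Arrow A) m where
  fam _ β z _ _ := Arrow.mk ((nerveGridIso φ β).hom.app z)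
  compat {y' _} g β z _ _ := IsoFull.arrow_app_eq (P := gridProp A y')
    (x.compat (idxHom g β)) (x'.compat (idxHom g β)).symm (GrpdLimit.Hom.compat φ (idxHom g β)) z

/-- Arrows and components of compatible families glue over `Ar[m]`, which gives surjectivity and
fullness. Since the rectangles cover `Ar[m]`, the functor is also faithful and injective on objects.
-/
theorem isIso_adjFunctor_comparisonAdj (n : SimplexCategoryᵒᵖ) :
    IsIso (adjFunctor (comparisonAdj A) n) := by
  obtain ⟨m⟩ := n
  refine IsTrivFib.isIso ⟨fun x => ?_, fun {F G} φ => ?_, fun {F G} a b h => ?_⟩ ?_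
  -- With cutoff `0` the grids miss no point of `Ar[m]`, so the restrictions of `F` are exactly the
  -- given grids.
  · obtain ⟨F, hF, -⟩ := (nerveArrows_functorial x).exists_functor (c := 0) (by omega)
      (isZero_zero A).isInitial
    have hF' {y : DeltaSq} (β : join.obj y ⟶ m) : gridPoint β ⋙ F = (nerveGrid x β).obj :=
      functor_eq_of_arrow_eq fun f => hF β f (Nat.zero_le _)
    refine ⟨⟨F, isAdmissible_of_gridPoint (c := 0) (by omega) (fun β _ => ?_)
      (fun _ h => (Nat.not_lt_zero _ h).elim), fun z hz => ?_⟩,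
      genLimit_obj_ext exactNerve_aug_injective fun β => IsoFull.obj_ext (hF' β)⟩
    · rw [hF']
      exact (nerveGrid x β).property
    · rw [← gridPoint_vertex hz]
      have := isZero_nerveGrid x (vertex z.left) (0, 0)
      rw [← hF'] at this
      exact this
  · obtain ⟨e, he⟩ := (nerveComponents φ).exists_iso (F := F.obj) (G := G.obj) 0
      (fun β _ => ⟨nerveGridIso φ β, fun z => rfl⟩) (fun _ h => (Nat.not_lt_zero _ h).elim)
      (fun _ h => (Nat.not_lt_zero _ h).elim)
    refine ⟨e, genLimit_hom_ext exactNerve_aug_faithful fun β => IsoFull.hom_ext fun z => ?_⟩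
    exact Arrow.mk_injective _ _ (he β z (Nat.zero_le _))
  · refine IsoFull.hom_ext fun z => ?_
    obtain ⟨β, rfl, -⟩ := exists_gridPoint_of_hom (𝟙 z) (ar_le z)
    exact congrArg (fun φ => (nerveGridIso φ β).hom.app (0, 0)) h
  · intro F G h
    refine IsoFull.obj_ext (functor_ext_of_gridPoint fun β => ?_)
    exact congrArg (fun x => (nerveGrid x β).obj) h

end Comparison

/-! ## Families on grids with an additional initial row -/

section PathFamilies

variable {S : Type*} {m : SimplexCategory}

/-- The object `([0] ⋆ [q], [r])`. -/
abbrev jObj (y : DeltaSq) : DeltaSq := (j.prod (𝟭 SimplexCategory)).obj y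

/-- The morphism `([0] ⋆ f, g)`. -/
abbrev jMap {y' y : DeltaSq} (g : y' ⟶ y) : jObj y' ⟶ jObj y := (j.prod (𝟭 SimplexCategory)).map g

theorem j_map_val_zero {n n' : SimplexCategory} (g : n ⟶ n') (i : Ord (j.obj n))
    (hi : i.val = 0) : ((j.map g).toOrderHom i).val = 0 := by
  refine (joinHom_left (𝟙 (⦋0⦌ : SimplexCategory)) g i (0 : Fin 1) hi).trans ?_
  rfl

theorem j_map_val_succ {n n' : SimplexCategory} (g : n ⟶ n') (i : Ord (j.obj n)) (a : Ord n)
    (hi : i.val = a.val + 1) : ((j.map g).toOrderHom i).val = (g.toOrderHom a).val + 1 := by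
  refine (joinHom_right (𝟙 (⦋0⦌ : SimplexCategory)) g i a (hi.trans (Nat.add_comm _ _))).trans ?_
  exact Nat.add_comm _ _

/-- The map `[0] ⋆ [m] ⟶ [m]` which is the identity on `[m]`. -/
def predHom (m : SimplexCategory) : j.obj m ⟶ m :=
  SimplexCategory.mkHom (n := 0 + m.len + 1) (m := m.len)
    { toFun := fun i => ⟨i.val - 1, by omega⟩
      monotone' := fun _ _ h => Fin.mk_le_mk.2 (Nat.sub_le_sub_right h 1) }

/-- The rows of `[0] ⋆ [q]` corresponding to the rows of a grid in `Ar([0] ⋆ [m])`. -/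
def rowHom {y : DeltaSq} (β : join.obj y ⟶ j.obj m) : Ord y.1 →o Ord (jObj y).1 where
  -- Rows lying over the initial vertex go to the added row `0`; every other row `a` goes to its
  -- copy `a + 1`.
  toFun a := (⟨if (β.toOrderHom (joinL y a)).val = 0 then 0 else a.val + 1, by split_ifs <;> omega⟩ :
    Fin (0 + y.1.len + 1 + 1))
  monotone' a b h := by
    have h₁ : a.val ≤ b.val := h
    have h₂ : (β.toOrderHom (joinL y a)).val ≤ (β.toOrderHom (joinL y b)).val :=
      β.toOrderHom.monotone (joinL_mono h)
    refine Fin.mk_le_mk.2 ?_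
    split_ifs <;> omega

/-- The inclusion of a grid in `Ar([0] ⋆ [m])` into a grid with an additional row. -/
abbrev rowFunctor {y : DeltaSq} (β : join.obj y ⟶ j.obj m) : Grid y ⥤ Grid (jObj y) :=
  (rowHom β).monotone.functor.prod (𝟭 _)

/-- The map `[0] ⋆ [q + 1 + r] ⟶ [0] ⋆ [m]` induced by `α`. -/
abbrev pathHom {y : DeltaSq} (α : join.obj y ⟶ m) : join.obj (jObj y) ⟶ j.obj m :=
  assocJ.app y ≫ j.map α

/-- `predHom` merges the vertices `0` and `1`, and adjoining a row shifts everything up again. The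
positive columns are thus recovered, and `rowHom` remembers which rows were at `0`. So each grid
avoiding column `0` is cut out of one with an additional row. -/
theorem rowFunctor_pathHom {y : DeltaSq} (β : join.obj y ⟶ j.obj m)
    (h : 1 ≤ (β.toOrderHom (joinR y 0)).val) :
    rowFunctor β ⋙ gridPoint (pathHom (β ≫ predHom m)) = gridPoint β := by
  refine CategoryTheory.Functor.ext (fun z => ?_) (fun _ _ _ => ar_hom_ext _ _)
  refine ar_ext (Fin.ext ?_) (Fin.ext ?_)
  · change ((pathHom (β ≫ predHom m)).toOrderHom (joinL (jObj y) (rowHom β z.1))).val =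
      (β.toOrderHom (joinL y z.1)).val
    by_cases hz : (β.toOrderHom (joinL y z.1)).val = 0
    · refine (j_map_val_zero (β ≫ predHom m) _ (if_pos hz)).trans hz.symm
    · refine (j_map_val_succ (β ≫ predHom m) _ (joinL y z.1) (if_neg hz)).trans ?_
      change (β.toOrderHom (joinL y z.1)).val - 1 + 1 = _
      omega
  · have hz : 1 ≤ (β.toOrderHom (joinR y z.2)).val :=
      h.trans (β.toOrderHom.monotone (joinR_mono (Fin.zero_le _)))
    change ((pathHom (β ≫ predHom m)).toOrderHom (joinR (jObj y) z.2)).val =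
      (β.toOrderHom (joinR y z.2)).val
    refine (j_map_val_succ (β ≫ predHom m) _ (joinR y z.2) ?_).trans ?_
    · change 0 + y.1.len + 1 + 1 + z.2.val = y.1.len + 1 + z.2.val + 1
      omega
    · change (β.toOrderHom (joinR y z.2)).val - 1 + 1 = _
      omega

theorem rowFunctor_obj_gridMap {y' y : DeltaSq} (g : y' ⟶ y) (β : join.obj y ⟶ j.obj m)
    (z : Grid y') : (rowFunctor β).obj ((gridMap g).obj z) =
      (gridMap (jMap g)).obj ((rowFunctor (join.map g ≫ β)).obj z) := by
  refine Prod.ext (Fin.ext ?_) rfl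
  change (rowHom β (g.1.toOrderHom z.1)).val =
    ((j.map g.1).toOrderHom (rowHom (join.map g ≫ β) z.1)).val
  have e : (join.map g ≫ β).toOrderHom (joinL y' z.1) =
      β.toOrderHom (joinL y (g.1.toOrderHom z.1)) := congrArg β.toOrderHom (join_map_joinL g z.1)
  by_cases hz : (β.toOrderHom (joinL y (g.1.toOrderHom z.1))).val = 0
  · exact (if_pos hz).trans (j_map_val_zero g.1 _ (if_pos (by rw [e]; exact hz))).symm
  · exact (if_neg hz).trans (j_map_val_succ g.1 _ z.1 (if_neg (by rw [e]; exact hz))).symm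

theorem toJ_pathHom_predHom {y : DeltaSq} (α : join.obj y ⟶ m) :
    join.map (show y ⟶ jObj y from (toJ.app y.1, 𝟙 _)) ≫ pathHom α ≫ predHom m = α := by
  have e : toJ.app m ≫ predHom m = 𝟙 m := hom_ext_val fun i => Nat.add_sub_cancel _ _
  have e' : join.map (show y ⟶ jObj y from (toJ.app y.1, 𝟙 _)) ≫ assocJ.app y =
      toJ.app (join.obj y) := joinHom_inclJ y.1 y.2
  have e'' : toJ.app (join.obj y) ≫ j.map α = α ≫ toJ.app m := (toJ.naturality α).symm
  rw [← Category.assoc, ← Category.assoc, e', e'', Category.assoc, e, Category.comp_id]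

/-- In `pathHom α` exactly the added row lies over the initial vertex. So `rowHom` fixes row `0` and
raises the others by one, skipping `1`, as does `[0] ⋆ -` applied to the inclusion. -/
theorem rowFunctor_obj_pathHom {y : DeltaSq} (α : join.obj y ⟶ m) (z : Grid (jObj y)) :
    (rowFunctor (pathHom α)).obj z =
      (gridMap (jMap (show y ⟶ jObj y from (toJ.app y.1, 𝟙 _)))).obj z := by
  refine Prod.ext (Fin.ext ?_) rfl
  change (rowHom (pathHom α) z.1).val = ((j.map (toJ.app y.1)).toOrderHom z.1).val
  by_cases hz : z.1.val = 0
  · refine Eq.trans (if_pos ?_) (j_map_val_zero (toJ.app y.1) z.1 hz).symm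
    exact j_map_val_zero α _ hz
  · have hlt : z.1.val - 1 < y.1.len + 1 := by
      have : z.1.val < 0 + y.1.len + 1 + 1 := z.1.isLt
      omega
    have h₁ : z.1.val = z.1.val - 1 + 1 := (Nat.succ_pred_eq_of_ne_zero hz).symm
    have h₂ := j_map_val_succ α ((assocJ.app y).toOrderHom (joinL (jObj y) z.1))
      (joinL y ⟨z.1.val - 1, hlt⟩) h₁
    refine (if_neg fun h => Nat.succ_ne_zero _ (h₂.symm.trans h)).trans ?_
    exact (congrArg (· + 1) h₁).trans
      (j_map_val_succ (toJ.app y.1) z.1 ⟨z.1.val - 1, hlt⟩ h₁).symm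

/-- A family of elements indexed by the morphisms of grids with an additional initial row. -/
structure PathFam (S : Type*) (m : SimplexCategory) where
  fam : ∀ (y : DeltaSq) (_ : join.obj y ⟶ m) {z z' : Grid (jObj y)} (_ : z ⟶ z'), S
  compat : ∀ {y' y : DeltaSq} (g : y' ⟶ y) (α : join.obj y ⟶ m) {z z' : Grid (jObj y')}
    (f : z ⟶ z'), fam y α ((gridMap (jMap g)).map f) = fam y' (join.map g ≫ α) f

namespace PathFam

theorem congr_arrow (W : PathFam S m) {y : DeltaSq} (α : join.obj y ⟶ m)
    {z z' w w' : Grid (jObj y)} (f : z ⟶ z') (g : w ⟶ w') (h : z = w) (h' : z' = w') :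
    W.fam y α f = W.fam y α g := by
  subst h h'
  rw [grid_hom_ext f g]

/-- The family on the grids in `Ar([0] ⋆ [m])` given by a family on grids with an additional
initial row. -/
def toArrFam (W : PathFam S m) : ArrFam S (j.obj m) where
  fam y β _ _ f := W.fam y (β ≫ predHom m) ((rowFunctor β).map f)
  compat g β z z' f :=
    (W.congr_arrow _ _ ((gridMap (jMap g)).map ((rowFunctor (join.map g ≫ β)).map f))
      (rowFunctor_obj_gridMap g β z) (rowFunctor_obj_gridMap g β z')).trans (W.compat g _ _)

/-- No information is lost in passing to grids of `Ar([0] ⋆ [m])`: adding a second initial row to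
`pathHom α` and restricting along the inclusion is undone by compatibility of `W`. -/
theorem toArrFam_pathHom (W : PathFam S m) {y : DeltaSq} (α : join.obj y ⟶ m)
    {z z' : Grid (jObj y)} (f : z ⟶ z') :
    W.toArrFam.fam (jObj y) (pathHom α) f = W.fam y α f := by
  have h := W.compat (show y ⟶ jObj y from (toJ.app y.1, 𝟙 _)) (pathHom α ≫ predHom m) f
  rw [toJ_pathHom_predHom] at h
  exact (W.congr_arrow _ _ _ (rowFunctor_obj_pathHom α z) (rowFunctor_obj_pathHom α z')).trans h

end PathFam

theorem one_le_pathHom {y : DeltaSq} (α : join.obj y ⟶ m) (b : Ord (jObj y).2) :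
    1 ≤ ((pathHom α).toOrderHom (joinR (jObj y) b)).val := by
  have h := j_map_val_succ α ((assocJ.app y).toOrderHom (joinR (jObj y) b)) (joinR y b)
    (by change 0 + y.1.len + 1 + 1 + b.val = y.1.len + 1 + b.val + 1; omega)
  exact (Nat.succ_le_succ (Nat.zero_le _)).trans h.ge

end PathFamilies

/-! ### Compatibility of the path comparison with `d₀` -/

section Relative

variable {C : Type*} [Category* C]

/-- Maps out of a restriction along `p` are determined by their components. -/
theorem Preaug.hom_ext {Y Y' : Preaug C} {α β : Y ⟶ Y'}
    (h : ∀ y, α.app (op (WithTerminal.of y)) = β.app (op (WithTerminal.of y)))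
    (h' : α.app (op WithTerminal.star) = β.app (op WithTerminal.star)) : α = β := by
  ext ⟨x⟩
  match x with
  | .of y => exact h y
  | .star => exact h'

theorem path_map_pathD₀ {X X' : SimplexCategoryᵒᵖ ⥤ C} (c : X ⟶ X') :
    (path C).map c ≫ pathD₀ X' = pathD₀ X ≫ c := by
  ext n
  exact (c.naturality (toJ.app n.unop).op).symm

variable [HasLimitsOfSize.{0, 0} C]

/-- In bidegrees this is the identity `joinHom_inclJ` followed by the counit; in degree `-1` it is
the second component of the map into the pullback. -/
theorem pathComparisonAdj_pathD₀ (Y : Preaug C) :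
    pathComparisonAdj Y ≫ Y.pathD₀ =
      Functor.whiskerLeft p.op (pathD₀ ((genS C).obj Y)) ≫ p.op.ranCounit.app Y := by
  refine Preaug.hom_ext (fun y => ?_) ?_
  · change (((genS C).obj Y).map (assocJ.app y).op ≫
        (p.op.ranCounit.app Y).app (op (WithTerminal.of ((j.prod (𝟭 _)).obj y)))) ≫
        Y.map (Quiver.Hom.op (WithTerminal.incl.map (show y ⟶ (j.prod (𝟭 _)).obj y from
          (toJ.app y.1, 𝟙 _)))) = _ ≫ _
    refine (Category.assoc _ _ _).trans ?_
    refine (congrArg (_ ≫ ·) ((p.op.ranCounit.app Y).naturality (Quiver.Hom.op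
      (WithTerminal.incl.map (show y ⟶ (j.prod (𝟭 _)).obj y from
        (toJ.app y.1, 𝟙 _))))).symm).trans ?_
    refine (Category.assoc _ _ _).symm.trans (congrArg (· ≫ _) ?_)
    refine (((genS C).obj Y).map_comp _ _).symm.trans ?_
    exact congrArg (fun t => ((genS C).obj Y).map (Quiver.Hom.op t)) (joinHom_inclJ y.1 y.2)
  · exact pullback.lift_snd _ _ _

theorem pathComparison_pathD₀ (Y : Preaug C) :
    pathComparison Y ≫ (genS C).map Y.pathD₀ = pathD₀ ((genS C).obj Y) := by
  have h := congrArg ((p.op.ranAdjunction C).homEquiv _ _) (pathComparisonAdj_pathD₀ Y)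
  refine ((Adjunction.homEquiv_naturality_right _ _ _).symm.trans h).trans ?_
  refine ((p.op.ranAdjunction C).homEquiv _ _).eq_symm_apply.1 ?_
  rw [Adjunction.homEquiv_counit, Functor.ranAdjunction_counit]
  rfl

end Relative

/-! ### The path construction of the exact nerve and the relative comparison -/

section Exact

variable {A : Type u} [Category.{v} A] [Preadditive A] [HasFiniteBiproducts A] [ExactCategory A]
variable {B : Type u} [Category.{v} B] [Preadditive B] [HasFiniteBiproducts B] [ExactCategory B]

/-- Restriction to grids commutes strictly with applying `f` to diagrams, so the adjuncts agree
definitionally. -/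
theorem comparison_naturality (f : A ⥤ B) [f.Additive] [IsExactFunctor f] :
    comparison A ≫ (genS _).map (exactNerveMap f) = exactSMap f ≫ comparison B := by
  refine (Adjunction.homEquiv_naturality_right _ _ _).symm.trans (Eq.trans ?_
    (Adjunction.homEquiv_naturality_left _ _ _))
  exact congrArg _ (Preaug.hom_ext (fun _ => rfl) rfl)

/-- The map `p^* P S^e(B) ⟶ P N^e(B)` adjoint to the composite of the comparison maps. -/
noncomputable def pathAdj (B : Type u) [Category.{v} B] [Preadditive B] [HasFiniteBiproducts B]
    [ExactCategory B] :
    p.op ⋙ (path _).obj (exactS B) ⟶ (exactNerve B).path :=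
  Functor.whiskerLeft p.op ((path _).map (comparison B)) ≫ pathComparisonAdj (exactNerve B)

theorem homEquiv_pathAdj : (p.op.ranAdjunction _).homEquiv _ _ (pathAdj B) =
    (path _).map (comparison B) ≫ pathComparison (exactNerve B) :=
  Adjunction.homEquiv_naturality_left _ _ _

/-- The comparison map followed by the counit is restriction to grids. In bidegrees, `pathAdj` is
therefore again a restriction, now along a grid with an additional row. -/
theorem pathAdj_app_of (y : DeltaSq) : (pathAdj B).app (op (WithTerminal.of y)) =
    (exactS B).map (assocJ.app y).op ≫ arToGrid B ((j.prod (𝟭 _)).obj y) := by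
  have h := NatTrans.congr_app (whisker_homEquiv_counit (comparisonAdj B))
    (op (WithTerminal.of ((j.prod (𝟭 _)).obj y)))
  refine Eq.trans (b := (comparison B).app _ ≫ (((genS _).obj (exactNerve B)).map (assocJ.app y).op ≫
        (p.op.ranCounit.app (exactNerve B)).app
          (op (WithTerminal.of ((j.prod (𝟭 _)).obj y))))) rfl ?_
  refine (Category.assoc _ _ _).symm.trans ?_
  refine (congrArg (· ≫ _) ((comparison B).naturality (assocJ.app y).op).symm).trans ?_
  refine (Category.assoc _ _ _).trans ?_
  exact congrArg ((exactS B).map (assocJ.app y).op ≫ ·) h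

section PathCase

variable {m : SimplexCategory}

theorem path_aug_injective (a b : (exactNerve B).path.augObj)
    (h : (exactNerve B).path.aug.obj a = (exactNerve B).path.aug.obj b) : a = b := by
  have pb := IsPullback.of_hasPullback ((exactNerve B).under.map (Quiver.Hom.op
    (show zz ⟶ jObj zz from (toJ.app ⦋0⦌, 𝟙 _)))) (exactNerve B).aug
  rw [show (exactNerve B).path.aug = _ from Preaug.mk_aug _ _ _] at h
  exact IsPullback.fst_obj_injective pb exactNerve_aug_injective h

theorem path_aug_faithful (a b : (exactNerve B).path.augObj) (s t : a ⟶ b)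
    (h : (exactNerve B).path.aug.map s = (exactNerve B).path.aug.map t) : s = t := by
  have pb := IsPullback.of_hasPullback ((exactNerve B).under.map (Quiver.Hom.op
    (show zz ⟶ jObj zz from (toJ.app ⦋0⦌, 𝟙 _)))) (exactNerve B).aug
  rw [show (exactNerve B).path.aug = _ from Preaug.mk_aug _ _ _] at h
  exact IsPullback.fst_map_injective pb exactNerve_aug_faithful h

/-- The grids of an object of `S_m(P N^e B)`. -/
def pathGrid (x : GrpdLimit (genDiagram (exactNerve B).path (op m))) {y : DeltaSq}
    (α : join.obj y ⟶ m) : IsoFull (gridProp B (jObj y)) :=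
  x.obj (idx α)

/-- The arrows in the grids of an object of `S_m(P N^e B)`. -/
def pathArrows (x : GrpdLimit (genDiagram (exactNerve B).path (op m))) :
    PathFam (Arrow B) m where
  fam _ α _ _ f := Arrow.mk ((pathGrid x α).obj.map f)
  compat {y' _} g α _ _ f := arrow_map_eq
    (congrArg (fun X : IsoFull (gridProp B (jObj y')) => X.obj) (x.compat (idxHom g α))) f

theorem pathArrows_functorial (x : GrpdLimit (genDiagram (exactNerve B).path (op m))) :
    (pathArrows x).toArrFam.Functorial where
  id _ β z := ⟨_, congrArg Arrow.mk ((rowFunctor β ⋙ (pathGrid x _).obj).map_id z)⟩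
  comp y β _ _ _ f g := by
    change IsComp _ _ (Arrow.mk ((rowFunctor β ⋙ (pathGrid x _).obj).map (f ≫ g)))
    rw [Functor.map_comp]
    exact isComp_mk _ _

/-- The augmentation of the path construction is a pullback over `d₀`: deleting the added row leaves
a zero object, which here is the entry in row `1`. -/
theorem isZero_pathGrid (x : GrpdLimit (genDiagram (exactNerve B).path (op m)))
    (i : (⦋0⦌ : SimplexCategory) ⟶ m) (z : Grid zz) :
    IsZero ((pathGrid x (y := zz) (p.map (WithTerminal.homFrom zz) ≫ i)).obj.obj
      ((gridMap (show zz ⟶ jObj zz from (toJ.app ⦋0⦌, 𝟙 _))).obj z)) := by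
  have pb := IsPullback.of_hasPullback ((exactNerve B).under.map (Quiver.Hom.op
    (show zz ⟶ jObj zz from (toJ.app ⦋0⦌, 𝟙 _)))) (exactNerve B).aug
  have h : (exactNerve B).path.aug.obj (x.obj (idxStar i)) =
      pathGrid x (y := zz) (p.map (WithTerminal.homFrom zz) ≫ i) := x.compat (idxAug i)
  rw [← h, show (exactNerve B).path.aug = _ from Preaug.mk_aug _ _ _]
  have h' := Functor.congr_obj pb.w (x.obj (idxStar i))
  exact IsZero.of_iso (isZero_exactNerve_aug _ z)
    (eqToIso (congrArg (fun X : IsoFull (gridProp B zz) => X.obj.obj z) h'))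

/-- The isomorphisms of grids which are the components of a morphism of `S_m(P N^e B)`. -/
def pathGridIso {x x' : GrpdLimit (genDiagram (exactNerve B).path (op m))} (φ : x ⟶ x')
    {y : DeltaSq} (α : join.obj y ⟶ m) : (pathGrid x α).obj ≅ (pathGrid x' α).obj :=
  GrpdLimit.Hom.app φ (idx α)

/-- The components of a morphism of `S_m(P N^e B)`. -/
def pathComponents {x x' : GrpdLimit (genDiagram (exactNerve B).path (op m))} (φ : x ⟶ x') :
    PathFam (Arrow B) m where
  fam _ α z _ _ := Arrow.mk ((pathGridIso φ α).hom.app z)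
  compat {y' _} g α z _ _ := IsoFull.arrow_app_eq (P := gridProp B (jObj y'))
    (x.compat (idxHom g α)) (x'.compat (idxHom g α)).symm (GrpdLimit.Hom.compat φ (idxHom g α)) z

theorem pathGrid_adjFunctor (F : IsoFull (arProp B (j.obj m))) {y : DeltaSq}
    (α : join.obj y ⟶ m) :
    (pathGrid ((adjFunctor (pathAdj B) (op m)).obj F) α).obj = gridPoint (pathHom α) ⋙ F.obj :=
  congrArg (fun X : IsoFull (gridProp B (jObj y)) => X.obj)
    (Functor.congr_obj (pathAdj_app_of (B := B) y) (((exactS B).map (j.map α).op).obj F))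

theorem pathGridIso_adjFunctor {F G : IsoFull (arProp B (j.obj m))} (a : F ⟶ G) {y : DeltaSq}
    (α : join.obj y ⟶ m) (z : Grid (jObj y)) :
    Arrow.mk ((pathGridIso ((adjFunctor (pathAdj B) (op m)).map a) α).hom.app z) =
      Arrow.mk (Iso.hom (show F.obj ≅ G.obj from a) |>.app ((gridPoint (pathHom α)).obj z)) :=
  IsoFull.arrow_app_eq (P := gridProp B (jObj y))
    (a := GrpdLimit.Hom.app ((adjFunctor (pathAdj B) (op m)).map a) (idx α)) _ _
    (Functor.congr_hom (pathAdj_app_of (B := B) y) (((exactS B).map (j.map α).op).map a)) z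

theorem rowFunctor_pathGrid (F : IsoFull (arProp B (j.obj m))) {y : DeltaSq}
    (β : join.obj y ⟶ j.obj m) (hβ : 1 ≤ (β.toOrderHom (joinR y 0)).val) :
    rowFunctor β ⋙ (pathGrid ((adjFunctor (pathAdj B) (op m)).obj F) (β ≫ predHom m)).obj =
      gridPoint β ⋙ F.obj := by
  rw [pathGrid_adjFunctor, ← Functor.assoc, rowFunctor_pathHom β hβ]

/-- A diagonal point `(i, i)` with `i ≥ 1` is row `1` of the grid attached to the vertex `i - 1` of
`[m]`, because every vertex of that grid except the added one goes to `i`. -/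
theorem gridPoint_pathHom_vertex {x : Ar (j.obj m)} (h : x.left = x.right)
    (hx : 1 ≤ x.right.val) :
    (gridPoint (pathHom (y := zz) (p.map (WithTerminal.homFrom zz) ≫
      vertex ((predHom m).toOrderHom x.right)))).obj
        ((gridMap (show zz ⟶ jObj zz from (toJ.app ⦋0⦌, 𝟙 _))).obj (0, 0)) = x := by
  have key (i : Ord (join.obj (jObj zz))) (hi : i.val ≠ 0) :
      (pathHom (y := zz) (p.map (WithTerminal.homFrom zz) ≫
        vertex ((predHom m).toOrderHom x.right))).toOrderHom i = x.right := by
    have hlt : i.val - 1 < 0 + 0 + 1 + 1 := by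
      have : i.val < 0 + 0 + 1 + 0 + 1 + 1 := i.isLt
      omega
    refine Fin.ext ((j_map_val_succ _ _ (⟨i.val - 1, hlt⟩ : Fin (0 + 0 + 1 + 1))
      (Nat.succ_pred_eq_of_ne_zero hi).symm).trans ?_)
    change x.right.val - 1 + 1 = x.right.val
    omega
  exact ar_ext ((key _ (Nat.succ_ne_zero 0)).trans h.symm) (key _ (Nat.succ_ne_zero _))

/-- The grids determine a diagram away from `(0, 0)`. There any zero object may be inserted, and
morphisms between zero objects are unique; injectivity on objects is what fails. -/
theorem isTrivFib_adjFunctor_pathAdj (n : SimplexCategoryᵒᵖ) :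
    IsTrivFib (adjFunctor (pathAdj B) n) := by
  obtain ⟨m⟩ := n
  have hz (F : IsoFull (arProp B (j.obj m))) (x : Ar (j.obj m)) (hx : x.right.val < 1) :
      IsZero (F.obj.obj x) := F.property.2 x (Fin.ext (by
    have := ord_le_val (ar_le x)
    omega))
  refine ⟨fun x => ?_, fun {F G} φ => ?_, fun {F G} a b h => ?_⟩
  -- Cutoff `1`: the chosen zero object of `B` becomes the value at `(0, 0)`, the only point with
  -- column `0`.
  · obtain ⟨F, hF, hF₀⟩ := (pathArrows_functorial x).exists_functor (c := 1) le_rfl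
      (isZero_zero B).isInitial
    have hF' {y : DeltaSq} (α : join.obj y ⟶ m) :
        gridPoint (pathHom α) ⋙ F = (pathGrid x α).obj :=
      functor_eq_of_arrow_eq fun f => (hF (pathHom α) f (one_le_pathHom α _)).trans
        ((pathArrows x).toArrFam_pathHom α f)
    have hF₁ (z : Ar (j.obj m)) (hz : z.right.val < 1) : IsZero (F.obj z) := by
      rw [hF₀ z hz]
      exact isZero_zero B
    refine ⟨⟨F, isAdmissible_of_gridPoint (c := 1) le_rfl (fun β hβ => ?_) hF₁, fun z hz => ?_⟩,
      genLimit_obj_ext path_aug_injective fun α =>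
        IsoFull.obj_ext ((pathGrid_adjFunctor _ α).trans (hF' α))⟩
    -- A square avoiding column `0` is a restriction of a given grid along `rowFunctor`, and so
    -- inherits its admissibility.
    · rw [← rowFunctor_pathHom β hβ, Functor.assoc, hF']
      refine (pathGrid x (β ≫ predHom m)).property.comp (rowFunctor β) (fun _ _ h => ?_)
        (fun _ _ h => h)
      exact congrArg (rowHom β) h
    · by_cases hz' : 1 ≤ z.right.val
      · rw [← gridPoint_pathHom_vertex hz hz']
        have := isZero_pathGrid x (vertex ((predHom m).toOrderHom z.right)) (0, 0)
        rw [← hF'] at this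
        exact this
      · exact hF₁ z (not_le.1 hz')
  · obtain ⟨e, he⟩ := (pathComponents φ).toArrFam.exists_iso (F := F.obj) (G := G.obj) 1
      (fun β hβ => exists_iso_of_eq
        (rowFunctor_pathGrid F β hβ) (rowFunctor_pathGrid G β hβ)
        (Functor.isoWhiskerLeft (rowFunctor β) (pathGridIso φ (β ≫ predHom m))))
      (fun x hx => ⟨(hz F x hx).isInitial⟩) (fun x hx => ⟨(hz G x hx).isInitial⟩)
    refine ⟨e, genLimit_hom_ext path_aug_faithful fun α => IsoFull.hom_ext fun z => ?_⟩
    refine Arrow.mk_injective _ _ ((pathGridIso_adjFunctor _ α z).trans ?_)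
    exact (he (pathHom α) z (one_le_pathHom α _)).trans
      ((pathComponents φ).toArrFam_pathHom α (𝟙 z))
  · refine IsoFull.hom_ext fun z => ?_
    by_cases hz' : 1 ≤ z.right.val
    · obtain ⟨β, rfl, -⟩ := exists_gridPoint_of_hom (𝟙 z) (ar_le z)
      rw [← rowFunctor_pathHom β hz']
      refine Arrow.mk_injective _ _ ((pathGridIso_adjFunctor a (β ≫ predHom m) _).symm.trans
        (Eq.trans ?_ (pathGridIso_adjFunctor b (β ≫ predHom m) _)))
      rw [h]
    · exact (hz F z (not_le.1 hz')).eq_of_src _ _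

end PathCase

instance isIso_comparison : IsIso (comparison A) := by
  have (n : SimplexCategoryᵒᵖ) : IsIso ((comparison A).app n) :=
    isIso_adjunct (isIso_adjFunctor_comparisonAdj n)
  exact NatIso.isIso_of_isIso_app _

theorem isTrivFib_path_comparison (n : SimplexCategoryᵒᵖ) :
    IsTrivFib (((path _).map (comparison B) ≫ pathComparison (exactNerve B)).app n) := by
  rw [← homEquiv_pathAdj]
  exact isTrivFib_adjunct (isTrivFib_adjFunctor_pathAdj n)

/-- The isomorphism `P(c_B)` is cancelled from the composite. -/
theorem isTrivFib_pathComparison (n : SimplexCategoryᵒᵖ) :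
    IsTrivFib ((pathComparison (exactNerve B)).app n) :=
  IsTrivFib.of_isIso_comp (G := ((path _).map (comparison B)).app n) (isTrivFib_path_comparison n)

theorem path_comparison_pathD₀ :
    ((path _).map (comparison B) ≫ pathComparison (exactNerve B)) ≫
      (genS _).map (exactNerve B).pathD₀ = pathD₀ (exactS B) ≫ comparison B := by
  rw [Category.assoc, pathComparison_pathD₀, path_map_pathD₀]

/-- The square relating the relative constructions to the path constructions is cartesian. -/
theorem exists_relComparison (f : A ⥤ B) [f.Additive] [IsExactFunctor f] :
    ∃ w : relS f ⟶ (genS _).obj (relNerve f),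
      IsPullback (pullback.fst _ _) w ((path _).map (comparison B) ≫
        pathComparison (exactNerve B)) ((genS _).map (pullback.fst _ _)) ∧
      w ≫ (genS _).map (pullback.snd _ _) = pullback.snd _ _ ≫ comparison A := by
  have : (genS Grpd.{v, max v u}).IsRightAdjoint := (p.op.ranAdjunction _).isRightAdjoint
  have pb : IsPullback ((genS _).map (pullback.fst (exactNerve B).pathD₀ (exactNerveMap f)))
      ((genS _).map (pullback.snd _ _)) ((genS _).map (exactNerve B).pathD₀)
      ((genS _).map (exactNerveMap f)) := (IsPullback.of_hasPullback _ _).map (genS _)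
  -- The defining square of `S^rel(f)` is pasted with the naturality square of `c`, which is
  -- cartesian because both comparison maps are invertible.
  have pb₀ : IsPullback (pullback.fst (pathD₀ (exactS B)) (exactSMap f)) (pullback.snd _ _ ≫
      comparison A) (pathD₀ (exactS B) ≫ comparison B) ((genS _).map (exactNerveMap f)) :=
    (IsPullback.of_hasPullback _ _).paste_vert (h₃₁ := (genS _).map (exactNerveMap f))
      (IsPullback.of_vert_isIso ⟨(comparison_naturality f).symm⟩)
  have e : (pullback.fst (pathD₀ (exactS B)) (exactSMap f) ≫ (path _).map (comparison B) ≫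
      pathComparison (exactNerve B)) ≫ (genS _).map (exactNerve B).pathD₀ =
      (pullback.snd _ _ ≫ comparison A) ≫ (genS _).map (exactNerveMap f) := by
    rw [Category.assoc, path_comparison_pathD₀]
    exact pb₀.w
  refine ⟨pb.lift _ _ e, ?_, pb.lift_snd _ _ _⟩
  -- By `path_comparison_pathD₀` the outer rectangle is `pb₀`; the lower square is `pb`. Hence the
  -- upper square is cartesian.
  refine IsPullback.of_bot ?_ (pb.lift_fst _ _ e).symm pb
  rw [pb.lift_snd, path_comparison_pathD₀]
  exact pb₀

end Exact

end Sdot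

theorem mainTheorem8 {A : Type u} [Category.{v} A] [Preadditive A] [HasFiniteBiproducts A]
    [Sdot.ExactCategory A] {B : Type u} [Category.{v} B] [Preadditive B] [HasFiniteBiproducts B]
    [Sdot.ExactCategory B] (f : A ⥤ B) [f.Additive] [Sdot.IsExactFunctor f] :
    IsIso (Sdot.comparison A) ∧ IsIso (Sdot.comparison B) ∧
    Sdot.LevelwiseAcyclicFibration (Sdot.pathComparison (Sdot.exactNerve B)) ∧
    ∃ w : Sdot.relS f ⟶ (Sdot.genS _).obj (Sdot.relNerve f),
      w ≫ (Sdot.genS _).map (pullback.fst _ _) =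
        pullback.fst _ _ ≫ (Sdot.path _).map (Sdot.comparison B) ≫
          Sdot.pathComparison (Sdot.exactNerve B) ∧
      w ≫ (Sdot.genS _).map (pullback.snd _ _) = pullback.snd _ _ ≫ Sdot.comparison A ∧
      Sdot.LevelwiseWeakEquivalence w := by
  refine ⟨inferInstance, inferInstance, fun n =>
    ⟨(Sdot.isTrivFib_pathComparison n).isEquivalence,
      (Sdot.isTrivFib_pathComparison n).isIsofibration⟩, ?_⟩
  obtain ⟨w, pb, hw⟩ := Sdot.exists_relComparison f
  refine ⟨w, pb.w.symm, hw, fun n => ?_⟩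
  -- Evaluation in degree `n` preserves the cartesian square, so `w` is there a base change of a
  -- surjective, fully faithful functor.
  exact (Sdot.IsTrivFib.of_isPullback (pb.map ((evaluation _ _).obj n))
    (Sdot.isTrivFib_path_comparison n)).isEquivalence
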